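/- Let $m\ge 1$ be an integer. For $1\le s\le m$ let $w_s\in C^{m-s}(\mathbb R)$ be of the form $w_s(x)=e^{\gamma_s x}r_s(x)$ with $\gamma_s\in\mathbb R$ and $r_s$ positive and $1$-periodic, and let $\mathcal U_m$ be the complex linear span of the functions $u_1=w_1$ and $$u_\ell(x)=w_1(x)\int_0^x w_2(x_2)\int_0^{x_2}w_3(x_3)\cdots\int_0^{x_{\ell-1}}w_\ell(x_\ell)\,dx_\ell\cdots dx_3\,dx_2,\qquad 2\le \ell\le m.$$ A periodic exponential B-spline (PEB-spline) of order $m$ supported on $[0,m]$ is a function $\varphi:\mathbb R\to\mathbb C$ with support $\operatorname{supp}\varphi=[0,m]$ which belongs to $C^{m-2}(\mathbb R)$ (no condition if $m=1$) and which on every interval $(k,k+1)$, $k\in\mathbb Z$, coincides with an element of $\mathcal U_m$, for some choice of weights $w_1,\dots,w_m$ as above. For $p\in[1,\infty]$ let $V^p(\varphi)=\{\sum_{\ell\in\mathbb Z}c_\ell\,\varphi(\cdot-\ell): c\in\ell^p(\mathbb Z)\}$. Let $X\subseteq\mathbb R$ and $\mu_X:X\to\{0,1,2,\dots\}$. The pair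 $(X,\mu_X)$ is called a sampling set for $V^p(\varphi)$ if every $f\in V^p(\varphi)$ is in $L^p(\mathbb R)$, all samples $f^{(s)}(x)$, $x\in X$, $0\le s\le\mu_X(x)$, exist (where $f^{(s)}(x)$ is understood as the right-sided limit of $f^{(s)}$ at $x$), and there are constants $A,B>0$ such that $$A\,\|f\|_{L^p}\le\Big(\sum_{x\in X}\sum_{s=0}^{\mu_X(x)}|f^{(s)}(x)|^p\Big)^{1/p}\le B\,\|f\|_{L^p}\qquad\text{for all } f\in V^p(\varphi),$$ with the supremum of the $|f^{(s)}(x)|$ in place of the middle term if $p=\infty$. **Theorem.** Let $\varphi$ be a PEB-spline of order $m\ge 1$ supported on $[0,m]$. Assume that (i) $X$ is separated, i.e. there is $\delta>0$ with $|x-y|\ge\delta$ for all distinct $x,y\in X$; (ii) $\mu_X(x)\le m-1$ for all $x\in X$; (iii) there exist integers $M\in\mathbb Z$, $L>0$ and a number $\varepsilon>0$ such that for every $k\in\mathbb Z$ there exist points $x_1^k<x_2^k<\dots<x_{N(k)}^k$ in $X\cap[M+kL,M+kL+L)$ and nonnegative integers $d_1^k,\dots,d_{N(k)}^k$ such that $$d_j^k\le\mu_X(x_j^k)\quad(1\le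 j\le N(k)),\qquad \sum_{j=1}^{N(k)}(1+d_j^k)=L+m-1,$$ $$x_j^k\in[\,d_j^k-m+\varepsilon,\,-\varepsilon\,]+M+kL+1+\sum_{n=1}^{j-1}(1+d_n^k)\quad(1\le j\le N(k)).$$ Then $(X,\mu_X)$ is a sampling set for $V^p(\varphi)$ for all $p\in[1,\infty]$. -/

import Mathlib

open MeasureTheory Filter Topology Set
open scoped ENNReal NNReal

/-- The nested integrals
`w_s(x) ∫₀ˣ w_{s+1}(x₁) ∫₀^{x₁} w_{s+2}(x₂) ⋯ ∫₀^{x_{n-1}} w_{s+n}(x_n) dx_n ⋯ dx₁`. -/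
noncomputable def nestedIntegral (w : ℕ → ℝ → ℝ) : ℕ → ℕ → ℝ → ℝ
  | s, 0 => w s
  | s, n + 1 => fun x => w s x * ∫ t in (0 : ℝ)..x, nestedIntegral w (s + 1) n t

/-- The functions `u_ℓ`, `ℓ = 1, 2, …`, of the extended complete Chebyshev system with weights
`w_1, w_2, …` (based at the point `0`), regarded as complex-valued functions:
`u_1 = w_1`, `u_2 (x) = w_1 (x) ∫₀ˣ w_2`, and so on. -/
noncomputable def eccFun (w : ℕ → ℝ → ℝ) (l : ℕ) : ℝ → ℂ :=
  fun x => (nestedIntegral w 1 (l - 1) x : ℂ)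

/-- The ECC-space `U_m = span_ℂ (u_1, …, u_m)`. It does not depend on the base point `0` of the
integrals. -/
noncomputable def eccSpace (w : ℕ → ℝ → ℝ) (m : ℕ) : Submodule ℂ (ℝ → ℂ) :=
  Submodule.span ℂ (eccFun w '' Icc 1 m)

/-- Periodic exponential weights `w_1, …, w_m` of order `m`: `w_s ∈ C^{m-s}(ℝ)` and
`w_s(x) = e^{γ_s x} r_s(x)` with `γ_s` real and `r_s` positive and `1`-periodic. -/
def IsPEBWeights (m : ℕ) (w : ℕ → ℝ → ℝ) : Prop :=
  ∀ s ∈ Icc 1 m, ContDiff ℝ ((m - s : ℕ) : WithTop ℕ∞) (w s) ∧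
    ∃ (γ : ℝ) (r : ℝ → ℝ), Function.Periodic r 1 ∧ (∀ x, 0 < r x) ∧
      ∀ x, w s x = Real.exp (γ * x) * r x

/-- Chebyshev splines of order `m` with integer knots for the weights `w_1, …, w_m`: functions in
`C^{m-2}(ℝ)` (no condition if `m = 1`) which on every interval `(k, k + 1)`, `k ∈ ℤ`, agree with an
element of the ECC-space. -/
def IsIntegerKnotSpline (m : ℕ) (w : ℕ → ℝ → ℝ) (φ : ℝ → ℂ) : Prop :=
  (∀ n : ℕ, n + 2 ≤ m → ContDiff ℝ (n : WithTop ℕ∞) φ) ∧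
    ∀ k : ℤ, ∃ u ∈ eccSpace w m, EqOn φ u (Ioo (k : ℝ) (k + 1))

/-- Periodic exponential B-splines (PEB-splines) of order `m`: the Chebyshev B-splines for integer
knots and periodic exponential weights, that is, the Chebyshev splines of order `m` for such data
whose support consists of exactly `m` consecutive knot intervals. -/
def IsPEBSpline (m : ℕ) (φ : ℝ → ℂ) : Prop :=
  ∃ w : ℕ → ℝ → ℝ, IsPEBWeights m w ∧ IsIntegerKnotSpline m w φ ∧
    ∃ j : ℤ, tsupport φ = Icc (j : ℝ) (j + m)

/-- The shift-invariant space `V^p(φ)`: all `∑_{ℓ ∈ ℤ} c_ℓ φ(· - ℓ)` with `c ∈ ℓ^p(ℤ)`. For a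
compactly supported `φ`, the sum has only finitely many nonzero terms at each point. -/
def shiftInvariantSpace (φ : ℝ → ℂ) (p : ℝ≥0∞) : Set (ℝ → ℂ) :=
  {f | ∃ c : ℤ → ℂ, Memℓp c p ∧ f = fun x => ∑' l : ℤ, c l * φ (x - l)}

/-- A set of real numbers whose distinct points have distance at least some `δ > 0`. -/
def IsSeparatedSet (X : Set ℝ) : Prop :=
  ∃ δ > (0 : ℝ), ∀ x ∈ X, ∀ y ∈ X, x ≠ y → δ ≤ |x - y|

/-- The sample `f^{(s)}(x)`, understood as the right-sided limit of `f^{(s)}` at `x`. It is the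
usual value of `f^{(s)}` wherever `f^{(s)}` is continuous. -/
noncomputable def sampleValue (f : ℝ → ℂ) (s : ℕ) (x : ℝ) : ℂ :=
  limUnder (𝓝[>] x) (iteratedDeriv s f)

/-- The sample `f^{(s)}(x)` is meaningful: `f` is `s` times continuously differentiable on some
interval `(x, x + r)` and `f^{(s)}` has a right-sided limit at `x`. -/
def HasSampleValue (f : ℝ → ℂ) (s : ℕ) (x : ℝ) : Prop :=
  (∃ r > (0 : ℝ), ContDiffOn ℝ (s : WithTop ℕ∞) f (Ioo x (x + r))) ∧
    ∃ v : ℂ, Tendsto (iteratedDeriv s f) (𝓝[>] x) (𝓝 v)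

/-- The `ℓ^p`-norm, in `[0, ∞]`, of the samples `f^{(s)}(x)`, `x ∈ X`, `0 ≤ s ≤ μ(x)`. -/
noncomputable def sampleNorm (X : Set ℝ) (μ : ℝ → ℕ) (p : ℝ≥0∞) (f : ℝ → ℂ) : ℝ≥0∞ :=
  if p = ∞ then ⨆ x ∈ X, ⨆ s ∈ Finset.range (μ x + 1), ‖sampleValue f s x‖ₑ
  else (∑' x : X, ∑ s ∈ Finset.range (μ x + 1), ‖sampleValue f s x‖ₑ ^ p.toReal) ^ (1 / p.toReal)

/-- `(X, μ)` is a sampling set for `V^p(φ)`: all functions in `V^p(φ)` are in `L^p` and have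
well-defined samples, and the `ℓ^p`-norm of the samples is equivalent to the `L^p`-norm on
`V^p(φ)`. Only the values of the multiplicity function `μ` on `X` matter. -/
def IsSamplingSet (X : Set ℝ) (μ : ℝ → ℕ) (φ : ℝ → ℂ) (p : ℝ≥0∞) : Prop :=
  (∀ f ∈ shiftInvariantSpace φ p,
    MemLp f p volume ∧ ∀ x ∈ X, ∀ s ≤ μ x, HasSampleValue f s x) ∧
  ∃ A B : ℝ≥0, 0 < A ∧ 0 < B ∧ ∀ f ∈ shiftInvariantSpace φ p,
    A * eLpNorm f p volume ≤ sampleNorm X μ p f ∧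
      sampleNorm X μ p f ≤ B * eLpNorm f p volume

/-! Write f = ∑ c_l φ(· - l). The sample norm and the L^p norm of f are both equivalent to the ℓ^p
norm of c, which takes four inequalities. The two upper bounds are local: at most m translates are
active at a point, their right-sided derivatives of order below m are uniformly bounded, and
separation of X limits how many samples one coefficient can dominate.

The lower bounds rest on a Schoenberg–Whitney theorem. On a block of length L only L + m - 1
coefficients are active, as many as there are chosen samples. Suppose these samples vanish but the
spline with exactly these coefficients does not, and let [p, q) be its first maximal run of nonzero
pieces. Its generalised derivatives (divide by a weight, differentiate) of order at most m - 2
vanish at p and q, so each of m - 1 Rolle steps gains one sign change. The last generalised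
derivative is a step function times w_m and has at most q - p - 1 sign changes, so there are at most
q - p - m zeros in (p, q). The interlacing of the nodes provides at least q - p - m + 1, a
contradiction (`IsPEBWeights.oscillates_le`, `IsPEBWeights.spline_coeff_eq_zero`).

Injectivity becomes a uniform estimate by compactness: with margin ε and separation δ the admissible
nodes form a compact set, and there are finitely many multiplicity patterns
(`IsPieces.exists_uniform_bound`). Hence each coefficient is bounded by a single sample in its
block, and `lpENorm_le_of_le_comp` passes to ℓ^p. Stability of c under the L^p norm is the same
estimate with L = 1, the nodes being points where |f| is smallest on m short subintervals of a unit
interval. -/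

/-! ### Nested integrals and generalised derivatives -/

theorem IsPEBWeights.contDiff {m : ℕ} {w : ℕ → ℝ → ℝ} (hw : IsPEBWeights m w) {s n : ℕ}
    (hs : 1 ≤ s) (hn : s + n ≤ m) : ContDiff ℝ (n : WithTop ℕ∞) (w s) :=
  (hw s ⟨hs, by omega⟩).1.of_le (by exact_mod_cast (by omega : n ≤ m - s))

theorem IsPEBWeights.pos {m : ℕ} {w : ℕ → ℝ → ℝ} (hw : IsPEBWeights m w) {s : ℕ}
    (hs : 1 ≤ s) (hn : s ≤ m) (x : ℝ) : 0 < w s x := by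
  obtain ⟨-, γ, r, -, hr, h⟩ := hw s ⟨hs, hn⟩
  rw [h]
  exact mul_pos (Real.exp_pos _) (hr x)

theorem IsPEBWeights.exists_add_int {m : ℕ} {w : ℕ → ℝ → ℝ} (hw : IsPEBWeights m w) {s : ℕ}
    (hs : 1 ≤ s) (hn : s ≤ m) (l : ℤ) : ∃ b : ℝ, ∀ x, w s (x + l) = b * w s x := by
  obtain ⟨-, γ, r, hp, -, h⟩ := hw s ⟨hs, hn⟩
  refine ⟨Real.exp (γ * l), fun x => ?_⟩
  have : r (x + l) = r x := by simpa using hp.int_mul l x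
  rw [h, h, this, mul_add, Real.exp_add]
  ring

/-- The primitive of a `C^n` function is `C^{n+1}`. -/
theorem contDiff_primitive {f : ℝ → ℝ} {n : ℕ} (hf : ContDiff ℝ (n : WithTop ℕ∞) f) :
    ContDiff ℝ ((n + 1 : ℕ) : WithTop ℕ∞) (fun x => ∫ t in (0 : ℝ)..x, f t) := by
  push_cast
  rw [contDiff_succ_iff_deriv]
  have h : deriv (fun x => ∫ t in (0 : ℝ)..x, f t) = f := by
    funext x
    exact Continuous.deriv_integral f hf.continuous 0 x
  refine ⟨fun x => (intervalIntegral.integral_hasDerivAt_right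
    (hf.continuous.intervalIntegrable _ _)
    (hf.continuous.stronglyMeasurableAtFilter _ _) hf.continuous.continuousAt).differentiableAt,
    by simp, by rwa [h]⟩

theorem IsPEBWeights.contDiff_nestedIntegral {m : ℕ} {w : ℕ → ℝ → ℝ} (hw : IsPEBWeights m w)
    (n : ℕ) : ∀ s r : ℕ, 1 ≤ s → s + n ≤ m → s + r ≤ m →
      ContDiff ℝ (r : WithTop ℕ∞) (nestedIntegral w s n) := by
  induction n with
  | zero =>
    intro s r hs _ hr
    exact hw.contDiff hs hr
  | succ n ih =>
    intro s r hs hn hr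
    have h1 := contDiff_primitive (ih (s + 1) (m - s - 1) (by omega) (by omega) (by omega))
    exact (hw.contDiff hs hr).mul
      (h1.of_le (by exact_mod_cast (by omega : r ≤ m - s - 1 + 1)))

/-- The translate of a nested integral by an integer is a combination of nested integrals. -/
theorem IsPEBWeights.nestedIntegral_add_int {m : ℕ} {w : ℕ → ℝ → ℝ} (hw : IsPEBWeights m w)
    (l : ℤ) (n : ℕ) : ∀ s : ℕ, 1 ≤ s → s + n ≤ m → ∃ b : ℕ → ℝ, ∀ x,
      nestedIntegral w s n (x + l) =
        ∑ i ∈ Finset.range (n + 1), b i * nestedIntegral w s i x := by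
  induction n with
  | zero =>
    intro s hs hn
    obtain ⟨b, hb⟩ := hw.exists_add_int hs hn l
    exact ⟨fun _ => b, fun x => by simpa [nestedIntegral] using hb x⟩
  | succ n ih =>
    intro s hs hn
    obtain ⟨b, hb⟩ := hw.exists_add_int hs (by omega) l
    obtain ⟨a, ha⟩ := ih (s + 1) (by omega) (by omega)
    have hc : ∀ i ≤ n, Continuous (nestedIntegral w (s + 1) i) := fun i hi =>
      (hw.contDiff_nestedIntegral i (s + 1) 0 (by omega) (by omega) (by omega)).continuous
    set C : ℝ := ∫ t in (0 : ℝ)..l, nestedIntegral w (s + 1) n t with hC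
    -- The integral up to x + l splits at l. The part over [0, l] is the constant C and contributes
    -- to index 0; the rest is translated back and, by induction, integrates to nested integrals of
    -- one higher index.
    refine ⟨fun i => Nat.casesOn i (b * C) (fun i => b * a i), fun x => ?_⟩
    have h1 : ∫ t in (0 : ℝ)..(x + l), nestedIntegral w (s + 1) n t
        = C + ∑ i ∈ Finset.range (n + 1), a i * ∫ t in (0 : ℝ)..x,
          nestedIntegral w (s + 1) i t := by
      rw [← intervalIntegral.integral_add_adjacent_intervals
        ((hc n le_rfl).intervalIntegrable 0 l) ((hc n le_rfl).intervalIntegrable _ _), ← hC]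
      congr 1
      have h2 := intervalIntegral.integral_comp_add_right
        (f := nestedIntegral w (s + 1) n) (a := 0) (b := x) (l : ℝ)
      rw [zero_add] at h2
      rw [← h2]
      simp_rw [ha]
      rw [intervalIntegral.integral_finsetSum]
      · simp_rw [intervalIntegral.integral_const_mul]
      · intro i hi
        exact ((hc i (by simpa [Nat.lt_succ_iff] using hi)).const_mul _ |>.intervalIntegrable _ _)
    rw [Finset.sum_range_succ']
    simp only [nestedIntegral]
    rw [h1, hb, mul_add, Finset.mul_sum, add_comm]
    congr 1
    · refine Finset.sum_congr rfl fun i _ => ?_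
      ring
    · change _ = b * C * w s x
      ring

/-- The `s`-th generalised derivative of `∑_{l < m} a_l N_l`, where `N_l` is the `l`-fold nested
integral of the weights. -/
noncomputable def chainSum (m : ℕ) (w : ℕ → ℝ → ℝ) (a : ℕ → ℝ) (s : ℕ) (x : ℝ) : ℝ :=
  ∑ l ∈ Finset.range (m - s), a (s + l) * nestedIntegral w (s + 1) l x

theorem IsPEBWeights.contDiff_chainSum {m : ℕ} {w : ℕ → ℝ → ℝ} (hw : IsPEBWeights m w)
    (a : ℕ → ℝ) {s r : ℕ} (hr : s + 1 + r ≤ m) :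
    ContDiff ℝ (r : WithTop ℕ∞) (chainSum m w a s) := by
  unfold chainSum
  refine ContDiff.sum fun l hl => contDiff_const.mul ?_
  have := Finset.mem_range.1 hl
  exact hw.contDiff_nestedIntegral l (s + 1) r (by omega) (by omega) (by omega)

theorem IsPEBWeights.continuous_chainSum {m : ℕ} {w : ℕ → ℝ → ℝ} (hw : IsPEBWeights m w)
    (a : ℕ → ℝ) {s : ℕ} (hs : s < m) : Continuous (chainSum m w a s) :=
  (hw.contDiff_chainSum (r := 0) a (by omega)).continuous

/-- Dividing by the outermost weight leaves a constant plus pure primitives, so differentiating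
peels off one integral. This is the link that Rolle's theorem uses between consecutive generalised
derivatives. -/
theorem IsPEBWeights.hasDerivAt_chainSum_div {m : ℕ} {w : ℕ → ℝ → ℝ} (hw : IsPEBWeights m w)
    (a : ℕ → ℝ) {s : ℕ} (hs : s < m) (x : ℝ) :
    HasDerivAt (fun x => chainSum m w a s x / w (s + 1) x) (chainSum m w a (s + 1) x) x := by
  have h0 : (fun x => chainSum m w a s x / w (s + 1) x) = fun x =>
      (∑ l ∈ Finset.range (m - (s + 1)), a (s + 1 + l) *
        ∫ t in (0 : ℝ)..x, nestedIntegral w (s + 1 + 1) l t) + a s := by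
    funext x
    have hp := (hw.pos (s := s + 1) (by omega) (by omega) x).ne'
    rw [chainSum, show m - s = m - (s + 1) + 1 by omega, Finset.sum_range_succ', add_div,
      Finset.sum_div]
    congr 1
    · refine Finset.sum_congr rfl fun l _ => ?_
      rw [nestedIntegral, show s + 1 + l = s + (l + 1) by omega]
      field_simp
    · simp [nestedIntegral, hp]
  rw [h0]
  refine HasDerivAt.add_const _ (HasDerivAt.fun_sum fun l hl => HasDerivAt.const_mul _ ?_)
  have hl' := Finset.mem_range.1 hl
  have hc : Continuous (nestedIntegral w (s + 1 + 1) l) :=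
    (hw.contDiff_nestedIntegral l (s + 1 + 1) 0 (by omega) (by omega) (by omega)).continuous
  exact intervalIntegral.integral_hasDerivAt_right (hc.intervalIntegrable _ _)
    (hc.stronglyMeasurableAtFilter _ _) hc.continuousAt

theorem chainSum_last {m : ℕ} (hm : 1 ≤ m) (w : ℕ → ℝ → ℝ) (a : ℕ → ℝ) (x : ℝ) :
    chainSum m w a (m - 1) x = a (m - 1) * w m x := by
  rw [chainSum, show m - (m - 1) = 1 by omega]
  simp [nestedIntegral, Nat.sub_add_cancel hm]

/-- Linear independence of the nested integrals on open intervals. -/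
theorem IsPEBWeights.coeff_eq_zero {m : ℕ} {w : ℕ → ℝ → ℝ} (hw : IsPEBWeights m w)
    (a : ℕ → ℝ) {α β : ℝ} (hαβ : α < β) (d : ℕ) : ∀ s, s + d = m →
      (∀ x ∈ Ioo α β, chainSum m w a s x = 0) → ∀ l, s ≤ l → l < m → a l = 0 := by
  induction d with
  | zero => intro s hs _ l h1 h2; omega
  | succ d ih =>
    intro s hs h0
    have h1 : ∀ x ∈ Ioo α β, chainSum m w a (s + 1) x = 0 := by
      intro x hx
      have hd := hw.hasDerivAt_chainSum_div a (s := s) (by omega) x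
      have : (fun x => chainSum m w a s x / w (s + 1) x) =ᶠ[𝓝 x] fun _ => 0 := by
        filter_upwards [isOpen_Ioo.mem_nhds hx] with y hy
        simp [h0 y hy]
      exact (hd.congr_of_eventuallyEq this.symm).unique (hasDerivAt_const x 0)
    have h2 := ih (s + 1) (by omega) h1
    intro l hl hlm
    rcases hl.lt_or_eq with h | rfl
    · exact h2 l h hlm
    · obtain ⟨x, hx⟩ := exists_between hαβ
      have h3 := h0 x hx
      rw [chainSum, show m - s = d + 1 by omega, Finset.sum_range_succ', Finset.sum_eq_zero] at h3
      · have hp := (hw.pos (s := s + 1) (by omega) (by omega) x).ne'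
        simpa [nestedIntegral, hp] using h3
      · intro i hi
        have := Finset.mem_range.1 hi
        rw [h2 _ (by omega) (by omega), zero_mul]

theorem iteratedDeriv_mul_eq_zero {f g : ℝ → ℝ} {n : ℕ} {t : ℝ}
    (hf : ContDiff ℝ (n : WithTop ℕ∞) f) (hg : ContDiff ℝ (n : WithTop ℕ∞) g)
    (h0 : ∀ j ≤ n, iteratedDeriv j f t = 0) (j : ℕ) (hj : j ≤ n) :
    iteratedDeriv j (f * g) t = 0 := by
  have hjn : (j : WithTop ℕ∞) ≤ n := by exact_mod_cast hj
  rw [iteratedDeriv_mul (hf.of_le hjn).contDiffAt (hg.of_le hjn).contDiffAt]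
  refine Finset.sum_eq_zero fun i hi => ?_
  rw [h0 i (by have := Finset.mem_range.1 hi; omega)]
  simp

/-- If the derivatives of order at most `d` vanish at `t`, so do the generalised ones. -/
theorem IsPEBWeights.chainSum_eq_zero {m : ℕ} {w : ℕ → ℝ → ℝ} (hw : IsPEBWeights m w)
    (a : ℕ → ℝ) {t : ℝ} {d : ℕ} (hd : d < m)
    (h0 : ∀ j ≤ d, iteratedDeriv j (chainSum m w a 0) t = 0) {s : ℕ} (hs : s ≤ d) :
    chainSum m w a s t = 0 := by
  -- The induction needs the stronger claim that the s-th generalised derivative vanishes at t with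
  -- all ordinary derivatives up to order d - s; the Leibniz rule absorbs the division by a weight.
  have key : ∀ s ≤ d, ∀ j ≤ d - s, iteratedDeriv j (chainSum m w a s) t = 0 := by
    intro s
    induction s with
    | zero => intro _ j hj; exact h0 j hj
    | succ s ih =>
      intro hs j hj
      have h1 : deriv (chainSum m w a s * fun x => (w (s + 1) x)⁻¹) = chainSum m w a (s + 1) := by
        funext x
        have := (hw.hasDerivAt_chainSum_div a (s := s) (by omega) x).deriv
        simpa [div_eq_mul_inv, Pi.mul_def] using this
      rw [← h1, ← iteratedDeriv_succ']
      refine iteratedDeriv_mul_eq_zero (n := d - s) (hw.contDiff_chainSum a (by omega)) ?_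
        (ih (by omega)) _ (by omega)
      exact (hw.contDiff (by omega) (by omega)).inv
        (fun x => (hw.pos (by omega) (by omega) x).ne')
  simpa using key s hs 0 (Nat.zero_le _)

/-- `Oscillates m H p q s y σ n`: the function `H s` has the sign of `σ` at `y` and at least `n`
sign changes or zeros, counted with multiplicities, on `(p, y)`. The multiplicity of a zero is
measured by the vanishing of `H s, H (s + 1), …`, and is one larger than the number of these
functions that vanish if the sign change requires it. -/
inductive Oscillates (m : ℕ) (H : ℕ → ℝ → ℝ) (p q : ℝ) (s : ℕ) : ℝ → ℝ → ℕ → Prop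
  | start (y σ : ℝ) (hp : p < y) (hq : y < q) (h : 0 < σ * H s y) : Oscillates m H p q s y σ 0
  | step (y t y' σ : ℝ) (e n : ℕ) (h : Oscillates m H p q s y σ n) (hyt : y < t) (hty : t < y')
      (hq : y' < q) (h0 : ∀ j, j + 1 < e → s + j < m ∧ H (s + j) t = 0)
      (h1 : 0 < (-1) ^ e * σ * H s y') : Oscillates m H p q s y' ((-1) ^ e * σ) (n + e)

theorem Oscillates.lt {m : ℕ} {H : ℕ → ℝ → ℝ} {p q : ℝ} {s : ℕ} {y σ : ℝ} {n : ℕ}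
    (h : Oscillates m H p q s y σ n) : p < y ∧ y < q ∧ 0 < σ * H s y := by
  induction h with
  | start y σ hp hq h => exact ⟨hp, hq, h⟩
  | step y t y' σ e n h hyt hty hq h0 h1 ih => exact ⟨by linarith, hq, h1⟩

/-- Rolle's theorem for oscillations. -/
theorem Oscillates.exists_succ_lt {m : ℕ} {H : ℕ → ℝ → ℝ} {p q : ℝ} {s : ℕ}
    {W : ℝ → ℝ} (hW : ∀ x, 0 < W x) (hp : H s p = 0)
    (hinc : ∀ x y σ : ℝ, p ≤ x → x < y → y ≤ q → 0 < σ * (H s y / W y - H s x / W x) →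
      ∃ z ∈ Ioo x y, 0 < σ * H (s + 1) z) {y σ : ℝ} {n : ℕ}
    (h : Oscillates m H p q s y σ n) : ∃ z < y, Oscillates m H p q (s + 1) z σ n := by
  have hdiv : ∀ {σ x : ℝ}, 0 < σ * H s x → 0 < σ * (H s x / W x) := by
    intro σ x h
    have := div_pos h (hW x)
    rwa [mul_div_assoc] at this
  induction h with
  | start y σ hpy hq h =>
    obtain ⟨z, hz, h'⟩ := hinc p y σ le_rfl hpy hq.le (by rw [hp]; simpa using hdiv h)
    exact ⟨z, hz.2, .start z σ hz.1 (hz.2.trans hq) h'⟩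
  | step y t y' σ e n h hyt hty hq h0 h1 ih =>
    obtain ⟨z, hzy, hz⟩ := ih
    obtain ⟨hpy, hyq, hy⟩ := h.lt
    -- For e = 0 nothing is added, and for e = 1 the quotient moves from sign σ to sign -σ. For e ≥
    -- 2 it passes through 0 at t: its derivative has sign -σ somewhere before t and (-1)^e σ
    -- somewhere after, so one oscillation falls before t and e - 1 remain at t.
    rcases e with _ | _ | e
    · exact ⟨z, by linarith, by simpa using hz⟩
    · have h2 := hdiv hy
      have h3 := hdiv h1
      obtain ⟨z', hz', h'⟩ := hinc y y' ((-1) ^ (0 + 1) * σ) hpy.le (by linarith) hq.le (by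
        simp only [zero_add, pow_one, neg_mul, one_mul] at h3 ⊢
        linarith)
      refine ⟨z', hz'.2, .step z ((z + z') / 2) z' σ (0 + 1) n hz ?_ ?_ (hz'.2.trans hq)
        (fun j hj => by omega) h'⟩
      · linarith [hz'.1]
      · linarith [hz'.1]
    · have ht := (h0 0 (by omega)).2
      rw [add_zero] at ht
      have h2 := hdiv hy
      have h3 := hdiv h1
      obtain ⟨z₁, hz₁, h₁⟩ := hinc y t ((-1) ^ 1 * σ) hpy.le hyt (by linarith) (by
        rw [ht]
        simp only [pow_one, neg_mul, one_mul, zero_div]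
        linarith)
      obtain ⟨z₂, hz₂, h₂⟩ := hinc t y' ((-1) ^ (e + 1 + 1) * σ) (by linarith) hty hq.le (by
        rw [ht]
        simpa using h3)
      have hs : (-1 : ℝ) ^ (e + 1) * ((-1) ^ 1 * σ) = (-1) ^ (e + 1 + 1) * σ := by ring
      have hosc : Oscillates m H p q (s + 1) z₁ ((-1) ^ 1 * σ) (n + 1) :=
        .step z ((z + z₁) / 2) z₁ σ 1 n hz (by linarith [hz₁.1]) (by linarith [hz₁.1])
          (by linarith [hz₁.2]) (fun j hj => by omega) h₁
      refine ⟨z₂, hz₂.2, ?_⟩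
      rw [← hs] at h₂ ⊢
      rw [show n + (e + 1 + 1) = n + 1 + (e + 1) by ring]
      refine .step z₁ t z₂ _ (e + 1) (n + 1) hosc hz₁.2 hz₂.1 (hz₂.2.trans hq) ?_ h₂
      intro j hj
      have := h0 (j + 1) (by omega)
      rwa [show s + (j + 1) = s + 1 + j by ring] at this

/-- The zero at p makes up for the change that Rolle's theorem usually loses; the zero at q forces
one more return towards 0 after the last oscillation, hence the gain of one. -/
theorem Oscillates.exists_succ {m : ℕ} {H : ℕ → ℝ → ℝ} {p q : ℝ} {s : ℕ}
    {W : ℝ → ℝ} (hW : ∀ x, 0 < W x) (hp : H s p = 0) (hq : H s q = 0)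
    (hinc : ∀ x y σ : ℝ, p ≤ x → x < y → y ≤ q → 0 < σ * (H s y / W y - H s x / W x) →
      ∃ z ∈ Ioo x y, 0 < σ * H (s + 1) z) {y σ : ℝ} {n : ℕ}
    (h : Oscillates m H p q s y σ n) : ∃ z σ', Oscillates m H p q (s + 1) z σ' (n + 1) := by
  obtain ⟨z, hzy, hz⟩ := h.exists_succ_lt hW hp hinc
  obtain ⟨hpy, hyq, hy⟩ := h.lt
  obtain ⟨z', hz', h'⟩ := hinc y q ((-1) ^ 1 * σ) hpy.le hyq le_rfl (by
    have := div_pos hy (hW y)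
    rw [mul_div_assoc] at this
    simpa [hq] using this)
  exact ⟨z', _, .step z ((z + z') / 2) z' σ 1 n hz (by linarith [hz'.1]) (by linarith [hz'.1])
    hz'.2 (fun j hj => by omega) h'⟩

/-- A step function with integer knots oscillates at most as often as it has knots. -/
theorem Oscillates.add_le_floor {m : ℕ} (hm : 1 ≤ m) {H : ℕ → ℝ → ℝ} {p q : ℤ}
    {W : ℝ → ℝ} (hW : ∀ x, 0 < W x) {c : ℤ → ℝ} (hH : ∀ x, H (m - 1) x = c ⌊x⌋ * W x)
    {y σ : ℝ} {n : ℕ} (h : Oscillates m H p q (m - 1) y σ n) :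
    p + n ≤ ⌊y⌋ ∧ 0 < σ * c ⌊y⌋ := by
  have hc : ∀ {x σ : ℝ}, 0 < σ * H (m - 1) x → 0 < σ * c ⌊x⌋ := by
    intro x σ h
    rw [hH, ← mul_assoc] at h
    exact pos_of_mul_pos_left h (hW x).le
  induction h with
  | start y σ hpy hq h => exact ⟨by simpa using Int.le_floor.2 hpy.le, hc h⟩
  | step y t y' σ e n h hyt hty hq h0 h1 ih =>
    obtain ⟨h2, h3⟩ := ih
    have h4 := hc h1
    refine ⟨?_, h4⟩
    have hf : ⌊y⌋ ≤ ⌊t⌋ := Int.floor_mono hyt.le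
    have hf' : ⌊t⌋ ≤ ⌊y'⌋ := Int.floor_mono hty.le
    -- A sign change crosses at least one knot. A zero at t between nonzero values crosses two, one
    -- on each side of t. For e ≥ 3 a generalised derivative of order m would be needed, which the
    -- bound s + j < m excludes.
    rcases e with _ | _ | _ | e
    · push_cast; omega
    · have : ⌊y⌋ ≠ ⌊y'⌋ := by
        intro heq
        rw [← heq] at h4
        simp at h4
        linarith
      push_cast; omega
    · have ht := (h0 0 (by omega)).2
      rw [add_zero, hH, mul_eq_zero, or_iff_left (hW t).ne'] at ht
      have h5 : ⌊y⌋ ≠ ⌊t⌋ := by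
        intro heq
        rw [heq, ht] at h3
        simp at h3
      have h6 : ⌊t⌋ ≠ ⌊y'⌋ := by
        intro heq
        rw [← heq, ht] at h4
        simp at h4
      push_cast; omega
    · have := (h0 1 (by omega)).1
      omega

/-- Zeros with multiplicities produce oscillations. -/
theorem exists_oscillates_of_zeros {m : ℕ} {H : ℕ → ℝ → ℝ} {p q : ℝ} {N : ℕ} {x : Fin N → ℝ}
    (hx : StrictMono x) (d : Fin N → ℕ) (hd : ∀ j, d j < m)
    (hne : ∀ α β : ℝ, p ≤ α → α < β → β ≤ q → ∃ y ∈ Ioo α β, H 0 y ≠ 0)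
    (J : Finset (Fin N)) : (∀ j ∈ J, x j ∈ Ioo p q ∧ ∀ r ≤ d j, H r (x j) = 0) →
      ∀ z, p < z → z ≤ q → (∀ j ∈ J, x j < z) →
      ∃ y < z, ∃ σ n, Oscillates m H p q 0 y σ n ∧ |σ| = 1 ∧ ∑ j ∈ J, (1 + d j) ≤ n := by
  induction J using Finset.induction_on_max with
  | empty =>
    intro _ z hz hzq _
    obtain ⟨y, hy, h⟩ := hne p z le_rfl hz hzq
    refine ⟨y, hy.2, SignType.sign (H 0 y), 0,
      .start _ _ hy.1 (by linarith [hy.2]) ?_, ?_, by simp⟩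
    · rw [sign_mul_self]; exact abs_pos.2 h
    · rcases lt_or_gt_of_ne h with h | h <;> simp [h]
  | insert a J ha ih =>
    intro hJ z hz hzq hJz
    have haJ : a ∉ J := fun h => lt_irrefl _ (ha a h)
    obtain ⟨⟨hpa, haq⟩, hra⟩ := hJ a (Finset.mem_insert_self _ _)
    obtain ⟨y, hy, σ, n, hosc, hσ, hn⟩ := ih (fun j hj => hJ j (Finset.mem_insert_of_mem hj))
      (x a) hpa haq.le (fun j hj => hx (ha j hj))
    have haz := hJz a (Finset.mem_insert_self _ _)
    obtain ⟨y', hy', h⟩ := hne (x a) z hpa.le haz hzq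
    have hsum : ∑ j ∈ insert a J, (1 + d j) = (1 + d a) + ∑ j ∈ J, (1 + d j) :=
      Finset.sum_insert haJ
    have hσ0 : σ ≠ 0 := by rintro rfl; simp at hσ
    -- A zero with multiplicity 1 + d a counts once more if the parity of the actual sign change
    -- demands it; e ≤ 2 + d a still asks only for the vanishing of orders up to d a.
    obtain ⟨e, he1, he2, he⟩ : ∃ e, 1 + d a ≤ e ∧ e ≤ 2 + d a ∧ 0 < (-1) ^ e * σ * H 0 y' := by
      have hne0 : (-1) ^ (1 + d a) * σ * H 0 y' ≠ 0 := by
        refine mul_ne_zero (mul_ne_zero (pow_ne_zero _ (by norm_num)) hσ0) h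
      rcases lt_or_gt_of_ne hne0 with h' | h'
      · refine ⟨2 + d a, by omega, le_rfl, ?_⟩
        rw [show 2 + d a = (1 + d a) + 1 by ring, pow_succ]
        linarith
      · exact ⟨1 + d a, le_rfl, by omega, h'⟩
    refine ⟨y', hy'.2, _, _, .step y (x a) y' σ e n hosc hy hy'.1 (by linarith [hy'.2]) ?_ he,
      by simpa [abs_mul] using hσ, by omega⟩
    intro j hj
    have := hd a
    exact ⟨by omega, by simpa using hra j (by omega)⟩

/-! ### Real splines with integer knots and the Schoenberg–Whitney theorem -/

/-- The right-continuous generalised derivatives of the spline with pieces `a k` on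
`[k, k + 1)`. -/
noncomputable def splineChain (m : ℕ) (w : ℕ → ℝ → ℝ) (a : ℤ → ℕ → ℝ) (s : ℕ) (x : ℝ) : ℝ :=
  chainSum m w (a ⌊x⌋) s x

theorem splineChain_of_mem {m : ℕ} {w : ℕ → ℝ → ℝ} {a : ℤ → ℕ → ℝ} {s : ℕ} {x : ℝ} {k : ℤ}
    (hx : x ∈ Ico (k : ℝ) (k + 1)) : splineChain m w a s x = chainSum m w (a k) s x := by
  rw [splineChain, Int.floor_eq_iff.2 hx]

theorem IsPEBWeights.eq_splineChain {m : ℕ} {w : ℕ → ℝ → ℝ} (hw : IsPEBWeights m w)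
    {a : ℤ → ℕ → ℝ} {s : ℕ} (hs : s < m) {F : ℝ → ℝ} (hF : Continuous F)
    (h : ∀ k : ℤ, EqOn F (chainSum m w (a k) s) (Ioo (k : ℝ) (k + 1))) :
    F = splineChain m w a s := by
  funext x
  have h1 := (h ⌊x⌋).of_subset_closure (t := Icc (⌊x⌋ : ℝ) (⌊x⌋ + 1)) hF.continuousOn
    (hw.continuous_chainSum (a ⌊x⌋) hs).continuousOn Ioo_subset_Icc_self
    (by rw [closure_Ioo (by simp)])
  exact h1 ⟨Int.floor_le x, (Int.lt_floor_add_one x).le⟩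

/-- Each generalised derivative costs one order of smoothness. The derivative of the quotient agrees
with the next piece inside each knot interval, and continuity extends this to the knots. -/
theorem IsPEBWeights.contDiff_splineChain {m : ℕ} {w : ℕ → ℝ → ℝ} (hw : IsPEBWeights m w)
    {a : ℤ → ℕ → ℝ} {h : ℝ → ℝ} (hreg : ∀ n : ℕ, n + 2 ≤ m → ContDiff ℝ (n : WithTop ℕ∞) h)
    (heq : ∀ k : ℤ, EqOn h (chainSum m w (a k) 0) (Ioo (k : ℝ) (k + 1))) (s : ℕ) :
    ∀ n : ℕ, s + n + 2 ≤ m → ContDiff ℝ (n : WithTop ℕ∞) (splineChain m w a s) := by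
  induction s with
  | zero =>
    intro n hn
    rw [← hw.eq_splineChain (by omega) (hreg 0 (by omega)).continuous heq]
    exact hreg n (by omega)
  | succ s ih =>
    intro n hn
    have h1 : ContDiff ℝ ((n + 1 : ℕ) : WithTop ℕ∞)
        (fun x => splineChain m w a s x / w (s + 1) x) :=
      (ih (n + 1) (by omega)).div (hw.contDiff (by omega) (by omega))
        (fun x => (hw.pos (by omega) (by omega) x).ne')
    push_cast at h1
    have h2 := (contDiff_succ_iff_deriv.1 h1).2.2
    rwa [hw.eq_splineChain (a := a) (s := s + 1) (by omega) h2.continuous] at h2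
    intro k x hx
    have h3 := hw.hasDerivAt_chainSum_div (a k) (s := s) (by omega) x
    refine (h3.congr_of_eventuallyEq ?_).deriv
    filter_upwards [isOpen_Ioo.mem_nhds hx] with y hy
    rw [splineChain_of_mem (Ioo_subset_Ico_self hy)]

/-- Mean value inequality for the generalised derivatives of a spline. -/
theorem IsPEBWeights.exists_splineChain_pos {m : ℕ} {w : ℕ → ℝ → ℝ} (hw : IsPEBWeights m w)
    {a : ℤ → ℕ → ℝ} {s : ℕ} (hs : s + 1 < m) (hc : Continuous (splineChain m w a s))
    {x y σ : ℝ} (hxy : x < y)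
    (h : 0 < σ * (splineChain m w a s y / w (s + 1) y - splineChain m w a s x / w (s + 1) x)) :
    ∃ z ∈ Ioo x y, 0 < σ * splineChain m w a (s + 1) z := by
  by_contra! hneg
  set g : ℝ → ℝ := fun x => splineChain m w a s x / w (s + 1) x with hg
  have hgc : Continuous g := hc.div (hw.contDiff (n := 0) (by omega) (by omega)).continuous
    (fun x => (hw.pos (by omega) (by omega) x).ne')
  -- Starting slightly to the right of x makes the sign assumption on the open interval suffice.
  have hpos : ∀ᶠ x' in 𝓝[>] x, 0 < σ * (g y - g x') := by
    have : ContinuousAt (fun x' => σ * (g y - g x')) x := by fun_prop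
    exact this.continuousWithinAt.eventually (lt_mem_nhds h)
  obtain ⟨x', hx', hx'm⟩ := (hpos.and (Ioo_mem_nhdsGT hxy)).exists
  -- Only right derivatives are available at knots, because the last generalised derivative may jump
  -- there.
  have hd : ∀ z, HasDerivWithinAt g (splineChain m w a (s + 1) z) (Ici z) z := by
    intro z
    have h3 := hw.hasDerivAt_chainSum_div (a ⌊z⌋) (s := s) (by omega) z
    refine (h3.hasDerivWithinAt (s := Ici z)).congr_of_eventuallyEq ?_ ?_
    · filter_upwards [Ico_mem_nhdsGE (Int.lt_floor_add_one z)] with u hu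
      have : u ∈ Ico (⌊z⌋ : ℝ) (⌊z⌋ + 1) := ⟨(Int.floor_le z).trans hu.1, hu.2⟩
      simp only [hg, splineChain_of_mem this]
    · rfl
  have := image_le_of_deriv_right_le_deriv_boundary (f := fun z => σ * g z)
    (f' := fun z => σ * splineChain m w a (s + 1) z) (a := x') (b := y)
    (B := fun _ => σ * g x') (B' := fun _ => 0) (by fun_prop)
    (fun z _ => (hd z).const_mul σ) le_rfl continuousOn_const
    (fun z _ => hasDerivWithinAt_const _ _ _)
    (fun z hz => hneg z ⟨hx'm.1.trans_le hz.1, hz.2⟩) (right_mem_Icc.2 hx'm.2.le)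
  linarith

/-- On an interval on whose pieces the spline does not vanish, and at whose end points it is
pasted to zero, the spline has few zeros. -/
theorem IsPEBWeights.oscillates_le {m : ℕ} (hm : 1 ≤ m) {w : ℕ → ℝ → ℝ} (hw : IsPEBWeights m w)
    {a : ℤ → ℕ → ℝ} (hc : ∀ s, s + 2 ≤ m → Continuous (splineChain m w a s)) {p q : ℤ}
    (hp : ∀ s, s + 2 ≤ m → splineChain m w a s p = 0)
    (hq : ∀ s, s + 2 ≤ m → splineChain m w a s q = 0) {y σ : ℝ} {n : ℕ}
    (h : Oscillates m (splineChain m w a) p q 0 y σ n) : p + n + m ≤ q := by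
  have key : ∀ s, s + 1 ≤ m → ∃ y σ, Oscillates m (splineChain m w a) p q s y σ (n + s) := by
    intro s
    induction s with
    | zero => exact fun _ => ⟨y, σ, h⟩
    | succ s ih =>
      intro hs
      obtain ⟨y, σ, h⟩ := ih (by omega)
      exact h.exists_succ (W := w (s + 1)) (hw.pos (by omega) (by omega)) (hp s (by omega))
        (hq s (by omega)) (fun x y σ _ hxy _ h0 =>
          hw.exists_splineChain_pos (by omega) (hc s (by omega)) hxy h0)
  obtain ⟨y, σ, h⟩ := key (m - 1) (by omega)
  have h1 := (h.add_le_floor hm (W := w m) (hw.pos hm le_rfl) (c := fun k => a k (m - 1))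
    (fun x => chainSum_last hm w _ x)).1
  have h2 : ⌊y⌋ < q := Int.floor_lt.2 h.lt.2.1
  push_cast [Nat.cast_sub hm] at h1
  omega

/-- The consecutive blocks of lengths 1 + d j tile {0, …, n - 1}; the block of i belongs to the last
j whose block starts at or before i. It assigns to each translate the node interlaced with it. -/
theorem exists_mem_block {N n : ℕ} (d : Fin N → ℕ) (hsum : ∑ j, (1 + d j) = n) {i : ℕ}
    (hi : i < n) : ∃ j, ∑ r ∈ Finset.Iio j, (1 + d r) ≤ i ∧
      i < ∑ r ∈ Finset.Iio j, (1 + d r) + (1 + d j) := by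
  have hN : 0 < N := by
    rcases Nat.eq_zero_or_pos N with rfl | h
    · simp at hsum; omega
    · exact h
  set S : Finset (Fin N) := Finset.univ.filter fun j => ∑ r ∈ Finset.Iio j, (1 + d r) ≤ i
  have hS : S.Nonempty := ⟨⟨0, hN⟩, by
    have : Finset.Iio (⟨0, hN⟩ : Fin N) = ∅ := by
      ext j; simp [Fin.lt_def]
    simp [S, this]⟩
  set j := S.max' hS with hj
  have hjS : j ∈ S := S.max'_mem hS
  refine ⟨j, (Finset.mem_filter.1 hjS).2, ?_⟩
  by_contra! hcon
  have hIic : ∑ r ∈ Finset.Iic j, (1 + d r) ≤ i := by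
    have : Finset.Iic j = insert j (Finset.Iio j) := by
      ext r; simp [le_iff_eq_or_lt]
    rw [this, Finset.sum_insert (by simp), add_comm]
    exact hcon
  by_cases hlast : (j : ℕ) + 1 < N
  · have h1 : (⟨j + 1, hlast⟩ : Fin N) ∈ S := by
      refine Finset.mem_filter.2 ⟨Finset.mem_univ _, ?_⟩
      have : Finset.Iio (⟨j + 1, hlast⟩ : Fin N) = Finset.Iic j := by
        ext r; rw [Finset.mem_Iio, Finset.mem_Iic, Fin.lt_def, Fin.le_iff_val_le_val]; exact Nat.lt_succ_iff
      rwa [this]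
    have h2 := S.le_max' _ h1
    rw [← hj, Fin.le_iff_val_le_val] at h2
    simp at h2
  · have : Finset.Iic j = Finset.univ := by
      ext r; simp only [Finset.mem_Iic, Finset.mem_univ, iff_true, Fin.le_iff_val_le_val]; omega
    rw [this, hsum] at hIic
    omega

/-- The Schoenberg–Whitney theorem for real Chebyshev splines with integer knots: a compactly
supported spline which vanishes on sufficiently interlaced points vanishes. -/
theorem IsPEBWeights.spline_coeff_eq_zero {m : ℕ} (hm : 1 ≤ m) {w : ℕ → ℝ → ℝ}
    (hw : IsPEBWeights m w) {a : ℤ → ℕ → ℝ} {h : ℝ → ℝ}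
    (hreg : ∀ n : ℕ, n + 2 ≤ m → ContDiff ℝ (n : WithTop ℕ∞) h)
    (heq : ∀ k : ℤ, EqOn h (chainSum m w (a k) 0) (Ioo (k : ℝ) (k + 1))) {n : ℕ}
    (hout : ∀ k : ℤ, (k < 0 ∨ (n : ℤ) + m - 1 ≤ k) → ∀ l < m, a k l = 0) {N : ℕ}
    {x : Fin N → ℝ} (hx : StrictMono x) (d : Fin N → ℕ) (hd : ∀ j, d j < m)
    (hsum : ∑ j, (1 + d j) = n)
    (hxl : ∀ j, (d j : ℝ) + (∑ r ∈ Finset.Iio j, (1 + d r) : ℕ) < x j)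
    (hxr : ∀ j, x j < (m : ℝ) + (∑ r ∈ Finset.Iio j, (1 + d r) : ℕ))
    (h0 : ∀ j, ∀ r ≤ d j, iteratedDeriv r (chainSum m w (a ⌊x j⌋) 0) (x j) = 0) :
    ∀ k, ∀ l < m, a k l = 0 := by
  by_contra hcon
  have hcon : ∃ k, ∃ l < m, a k l ≠ 0 := by push Not at hcon; exact hcon
  -- p is the first nonzero piece and q the first zero piece after it, so no piece in [p, q)
  -- vanishes.
  obtain ⟨p, hpne, hpmin⟩ := Int.exists_least_of_bdd (P := fun k => ∃ l < m, a k l ≠ 0)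
    ⟨0, fun z ⟨l, hl, hz⟩ => by
      by_contra hz0
      exact hz (hout z (Or.inl (by omega)) l hl)⟩ hcon
  obtain ⟨q, ⟨hpq, hq0⟩, hqmin⟩ := Int.exists_least_of_bdd
    (P := fun k => p < k ∧ ∀ l < m, a k l = 0) ⟨p, fun z hz => hz.1.le⟩
    ⟨max (p + 1) (n + m - 1), by omega, hout _ (Or.inr (by omega))⟩
  have hp0 : 0 ≤ p := by
    by_contra hp
    obtain ⟨l, hl, h⟩ := hpne
    exact h (hout p (Or.inl (by omega)) l hl)
  have hpn : p < n + m - 1 := by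
    by_contra hp
    obtain ⟨l, hl, h⟩ := hpne
    exact h (hout p (Or.inr (by omega)) l hl)
  have hqn : q ≤ n + m - 1 := hqmin _ ⟨hpn, hout _ (Or.inr le_rfl)⟩
  have hzero : ∀ k, (∀ l < m, a k l = 0) → ∀ s, ∀ x, chainSum m w (a k) s x = 0 := by
    intro k hk s x
    refine Finset.sum_eq_zero fun l hl => ?_
    rw [hk _ (by have := Finset.mem_range.1 hl; omega), zero_mul]
  have hcont : ∀ s, s + 2 ≤ m → Continuous (splineChain m w a s) := fun s hs =>
    (hw.contDiff_splineChain hreg heq s 0 (by omega)).continuous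
  have hpz : ∀ s, s + 2 ≤ m → splineChain m w a s p = 0 := by
    intro s hs
    have h1 : EqOn (splineChain m w a s) (fun _ => 0) (Ioo ((p : ℝ) - 1) p) := by
      intro y hy
      have h2 : y ∈ Ico ((p - 1 : ℤ) : ℝ) ((p - 1 : ℤ) + 1) := by
        push_cast; exact ⟨hy.1.le, by linarith [hy.2]⟩
      rw [splineChain_of_mem h2]
      refine hzero _ ?_ s y
      by_contra! hne
      have := hpmin _ hne
      omega
    have h2 := h1.of_subset_closure (t := Icc ((p : ℝ) - 1) p) (hcont s hs).continuousOn
      continuousOn_const Ioo_subset_Icc_self (by rw [closure_Ioo (by simp)])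
    exact h2 (right_mem_Icc.2 (by linarith))
  have hqz : ∀ s, s + 2 ≤ m → splineChain m w a s q = 0 := by
    intro s hs
    rw [splineChain_of_mem (k := q) (by simp)]
    exact hzero q hq0 s q
  have hne : ∀ α β : ℝ, (p : ℝ) ≤ α → α < β → β ≤ q →
      ∃ y ∈ Ioo α β, splineChain m w a 0 y ≠ 0 := by
    intro α β hα hαβ hβ
    by_contra! hall
    have hk1 : p ≤ ⌊α⌋ := Int.le_floor.2 hα
    have hk2 : ⌊α⌋ < q := Int.floor_lt.2 (by linarith)
    have hmin : α < min β (⌊α⌋ + 1) := lt_min hαβ (Int.lt_floor_add_one α)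
    have hco := hw.coeff_eq_zero (a ⌊α⌋) hmin m 0 (by omega) (by
      intro y hy
      rw [← splineChain_of_mem (a := a)]
      · exact hall y ⟨hy.1, hy.2.trans_le (min_le_left _ _)⟩
      · exact ⟨(Int.floor_le α).trans hy.1.le, hy.2.trans_le (min_le_right _ _)⟩)
    rcases hk1.lt_or_eq with hk | hk
    · have := hqmin _ ⟨hk, fun l hl => hco l (Nat.zero_le _) hl⟩
      omega
    · obtain ⟨l, hl, h⟩ := hpne
      exact h (hk ▸ hco l (Nat.zero_le _) hl)
  set J : Finset (Fin N) := Finset.univ.filter fun j => x j ∈ Ioo (p : ℝ) q with hJ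
  obtain ⟨y, -, σ, k, hosc, -, hk⟩ := exists_oscillates_of_zeros
    (H := splineChain m w a) (p := p) (q := q) hx d hd hne J (by
      intro j hj
      refine ⟨(Finset.mem_filter.1 hj).2, fun r hr => ?_⟩
      exact hw.chainSum_eq_zero _ (hd j) (h0 j) hr) q (by exact_mod_cast hpq) le_rfl
      (fun j hj => (Finset.mem_filter.1 hj).2.2)
  have hle := hw.oscillates_le hm hcont hpz hqz hosc
  -- A translate with index i in [p, q - m] is supported in [p, q], and the node whose block
  -- contains i lies inside (p, q). Hence the multiplicities in (p, q) add up to at least q - m + 1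
  -- - p.
  have hcover : Finset.Ico p.toNat (q - m + 1).toNat ⊆ J.biUnion fun j =>
      Finset.Ico (∑ r ∈ Finset.Iio j, (1 + d r)) (∑ r ∈ Finset.Iio j, (1 + d r) + (1 + d j)) := by
    intro i hi
    rw [Finset.mem_Ico] at hi
    obtain ⟨j, hj1, hj2⟩ := exists_mem_block d hsum (i := i) (by omega)
    refine Finset.mem_biUnion.2 ⟨j, Finset.mem_filter.2 ⟨Finset.mem_univ _, ?_, ?_⟩,
      Finset.mem_Ico.2 ⟨hj1, hj2⟩⟩
    · refine lt_of_le_of_lt ?_ (hxl j)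
      have : p ≤ (d j : ℤ) + (∑ r ∈ Finset.Iio j, (1 + d r) : ℕ) := by omega
      exact_mod_cast this
    · refine (hxr j).trans_le ?_
      have : (m : ℤ) + (∑ r ∈ Finset.Iio j, (1 + d r) : ℕ) ≤ q := by omega
      exact_mod_cast this
  have hcard := (Finset.card_le_card hcover).trans Finset.card_biUnion_le
  simp only [Nat.card_Ico, add_tsub_cancel_left] at hcard
  omega

/-! ### Complex splines, their pieces and integer translates -/

theorem iteratedDeriv_clm_comp {E F : Type*} [NormedAddCommGroup E] [NormedSpace ℝ E]
    [NormedAddCommGroup F] [NormedSpace ℝ F] (L : E →L[ℝ] F) (n : ℕ) :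
    ∀ {f : ℝ → E}, ContDiff ℝ (n : WithTop ℕ∞) f →
      iteratedDeriv n (fun x => L (f x)) = fun x => L (iteratedDeriv n f x) := by
  induction n with
  | zero => intro f _; simp
  | succ n ih =>
    intro f hf
    push_cast at hf
    have h1 := contDiff_succ_iff_deriv.1 hf
    have h2 : deriv (fun x => L (f x)) = fun x => L (deriv f x) := by
      funext x
      exact (L.hasFDerivAt.comp_hasDerivAt x (h1.1 x).hasDerivAt).deriv
    rw [iteratedDeriv_succ', iteratedDeriv_succ', h2, ih h1.2.2]

theorem exists_coeff_of_mem_eccSpace {m : ℕ} {w : ℕ → ℝ → ℝ} {u : ℝ → ℂ}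
    (hu : u ∈ eccSpace w m) : ∃ A : ℕ → ℂ, ∀ x,
      u x = ∑ l ∈ Finset.range m, A l * (nestedIntegral w 1 l x : ℂ) := by
  induction hu using Submodule.span_induction with
  | mem u hu =>
    obtain ⟨l, hl, rfl⟩ := hu
    refine ⟨fun i => if i = l - 1 then 1 else 0, fun x => ?_⟩
    have := hl.1
    have := hl.2
    rw [Finset.sum_eq_single_of_mem (l - 1) (Finset.mem_range.2 (by omega))]
    · simp [eccFun]
    · intro i _ hi
      simp [hi]
  | zero => exact ⟨0, fun x => by simp⟩
  | add u v _ _ hu hv =>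
    obtain ⟨A, hA⟩ := hu
    obtain ⟨B, hB⟩ := hv
    exact ⟨A + B, fun x => by simp [hA, hB, add_mul, Finset.sum_add_distrib]⟩
  | smul c u _ hu =>
    obtain ⟨A, hA⟩ := hu
    exact ⟨fun l => c * A l, fun x => by simp [hA, Finset.mul_sum, mul_assoc]⟩

theorem IsPEBWeights.contDiff_of_mem_eccSpace {m : ℕ} {w : ℕ → ℝ → ℝ} (hw : IsPEBWeights m w)
    {u : ℝ → ℂ} (hu : u ∈ eccSpace w m) {r : ℕ} (hr : r < m) :
    ContDiff ℝ (r : WithTop ℕ∞) u := by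
  obtain ⟨A, hA⟩ := exists_coeff_of_mem_eccSpace hu
  rw [show u = _ from funext hA]
  refine ContDiff.sum fun l hl => contDiff_const.mul ?_
  have := Finset.mem_range.1 hl
  exact Complex.ofRealCLM.contDiff.comp
    (hw.contDiff_nestedIntegral l 1 r le_rfl (by omega) (by omega))

/-- This is where the periodic exponential form of the weights matters: integer translation only
rescales each weight, so combinations of translates of φ remain splines for the same weights. -/
theorem IsPEBWeights.comp_add_int_mem_eccSpace {m : ℕ} {w : ℕ → ℝ → ℝ} (hw : IsPEBWeights m w)
    {u : ℝ → ℂ} (hu : u ∈ eccSpace w m) (k : ℤ) : (fun x => u (x + k)) ∈ eccSpace w m := by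
  induction hu using Submodule.span_induction with
  | mem u hu =>
    obtain ⟨l, hl, rfl⟩ := hu
    have h1 := hl.1
    have h2 := hl.2
    obtain ⟨b, hb⟩ := hw.nestedIntegral_add_int k (l - 1) 1 le_rfl (by omega)
    have : (fun x : ℝ => eccFun w l (x + k)) =
        ∑ i ∈ Finset.range (l - 1 + 1), (b i : ℂ) • eccFun w (i + 1) := by
      funext x
      simp [eccFun, hb]
    rw [this]
    refine Submodule.sum_mem _ fun i hi => Submodule.smul_mem _ _ (Submodule.subset_span ?_)
    have := Finset.mem_range.1 hi
    exact ⟨i + 1, ⟨by omega, by omega⟩, rfl⟩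
  | zero => exact Submodule.zero_mem _
  | add u v _ _ hu hv => exact Submodule.add_mem _ hu hv
  | smul c u _ hu => exact Submodule.smul_mem _ c hu

/-- A family of ECC-functions `u k` that represents the spline `φ`, supported on `[0, m]`, on the
intervals `(k, k + 1)`. -/
structure IsPieces (m : ℕ) (w : ℕ → ℝ → ℝ) (φ : ℝ → ℂ) (u : ℤ → ℝ → ℂ) : Prop where
  weights : IsPEBWeights m w
  smooth : ∀ n : ℕ, n + 2 ≤ m → ContDiff ℝ (n : WithTop ℕ∞) φ
  mem : ∀ k, u k ∈ eccSpace w m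
  eqOn : ∀ k : ℤ, EqOn φ (u k) (Ioo (k : ℝ) (k + 1))
  eq_zero : ∀ k : ℤ, (k < 0 ∨ m ≤ k) → u k = 0
  exists_ne : ∃ x ∈ Ioo (0 : ℝ) 1, φ x ≠ 0

theorem IsPEBSpline.exists_isPieces {m : ℕ} (hm : 1 ≤ m) {φ : ℝ → ℂ} (hφ : IsPEBSpline m φ)
    (hsupp : tsupport φ = Icc (0 : ℝ) m) : ∃ w u, IsPieces m w φ u := by
  obtain ⟨w, hw, ⟨hs, hu⟩, -⟩ := hφ
  have hz : ∀ x : ℝ, x ∉ Icc (0 : ℝ) m → φ x = 0 := fun x hx =>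
    image_eq_zero_of_notMem_tsupport (hsupp ▸ hx)
  choose u hum hue using hu
  refine ⟨w, fun k => if k < 0 ∨ m ≤ k then 0 else u k, hw, hs, fun k => ?_, fun k => ?_,
    fun k hk => if_pos hk, ?_⟩
  · split_ifs
    · exact Submodule.zero_mem _
    · exact hum k
  · split_ifs with h
    · intro x hx
      refine hz x fun hx' => ?_
      rcases h with h | h
      · have h1 : (k : ℝ) + 1 ≤ 0 := by exact_mod_cast h
        linarith [hx'.1, hx.2]
      · have h1 : (m : ℝ) ≤ k := by exact_mod_cast h
        linarith [hx'.2, hx.1]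
    · exact hue k
  -- The support starts at 0, so φ cannot vanish throughout (0, 1).
  · have h1 : (1 / 2 : ℝ) ∈ tsupport φ := by
      rw [hsupp]
      have : (1 : ℝ) ≤ m := by exact_mod_cast hm
      exact ⟨by norm_num, by linarith⟩
    obtain ⟨x, hx, hx'⟩ := mem_closure_iff.1 h1 (Ioo 0 1) isOpen_Ioo (by norm_num)
    exact ⟨x, hx, hx'⟩

/-- The right-continuous `s`-th derivative of the function with pieces `u k` on `[k, k + 1)`. -/
noncomputable def pieceDeriv (u : ℤ → ℝ → ℂ) (s : ℕ) (y : ℝ) : ℂ :=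
  iteratedDeriv s (u ⌊y⌋) y

/-- The `k`-th piece of a combination of integer translates. -/
noncomputable def translateSum {ι : Type*} (u : ℤ → ℝ → ℂ) (S : Finset ι) (g : ι → ℤ) (c : ι → ℂ)
    (k : ℤ) (x : ℝ) : ℂ :=
  ∑ i ∈ S, c i * u (k - g i) (x - g i)

namespace IsPieces

variable {m : ℕ} {w : ℕ → ℝ → ℝ} {φ : ℝ → ℂ} {u : ℤ → ℝ → ℂ}

theorem contDiff (P : IsPieces m w φ u) (k : ℤ) {r : ℕ} (hr : r < m) :
    ContDiff ℝ (r : WithTop ℕ∞) (u k) :=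
  P.weights.contDiff_of_mem_eccSpace (P.mem k) hr

theorem translateSum_mem (P : IsPieces m w φ u) {ι : Type*} (S : Finset ι) (g : ι → ℤ)
    (c : ι → ℂ) (k : ℤ) : translateSum u S g c k ∈ eccSpace w m := by
  have : translateSum u S g c k = ∑ i ∈ S, c i • fun x => u (k - g i) (x + ((-g i : ℤ) : ℝ)) := by
    funext x
    simp [translateSum, sub_eq_add_neg]
  rw [this]
  exact Submodule.sum_mem _ fun i _ => Submodule.smul_mem _ _
    (P.weights.comp_add_int_mem_eccSpace (P.mem _) _)

theorem iteratedDeriv_translateSum (P : IsPieces m w φ u) {ι : Type*} (S : Finset ι)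
    (g : ι → ℤ) (c : ι → ℂ) {r : ℕ} (hr : r < m) (x : ℝ) :
    iteratedDeriv r (translateSum u S g c ⌊x⌋) x =
      ∑ i ∈ S, c i * pieceDeriv u r (x - g i) := by
  unfold translateSum
  have hc : ∀ i, ContDiff ℝ (r : WithTop ℕ∞) (fun y : ℝ => u (⌊x⌋ - g i) (y - g i)) := fun i =>
    (P.contDiff _ hr).comp (contDiff_id.sub contDiff_const)
  rw [iteratedDeriv_fun_sum fun i _ => (contDiff_const.mul (hc i)).contDiffAt]
  refine Finset.sum_congr rfl fun i _ => ?_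
  rw [iteratedDeriv_const_mul _ (hc i).contDiffAt, iteratedDeriv_comp_sub_const, pieceDeriv,
    Int.floor_sub_intCast]

theorem comp_sub_eq (P : IsPieces m w φ u) {k l : ℤ} {x : ℝ}
    (hx : x ∈ Ioo (k : ℝ) (k + 1)) : φ (x - l) = u (k - l) (x - l) := by
  refine P.eqOn (k - l) ⟨?_, ?_⟩
  · push_cast; linarith [hx.1]
  · push_cast; linarith [hx.2]

/-- Schoenberg–Whitney theorem for the translates of a PEB-spline. -/
theorem coeff_eq_zero (P : IsPieces m w φ u) (hm : 1 ≤ m) {N n : ℕ} {x : Fin N → ℝ}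
    (hx : StrictMono x) (d : Fin N → ℕ) (hd : ∀ j, d j < m) (hsum : ∑ j, (1 + d j) = n)
    (hxl : ∀ j, (d j : ℝ) + (∑ r ∈ Finset.Iio j, (1 + d r) : ℕ) < x j)
    (hxr : ∀ j, x j < (m : ℝ) + (∑ r ∈ Finset.Iio j, (1 + d r) : ℕ)) (c : Fin n → ℂ)
    (h0 : ∀ j, ∀ r ≤ d j, ∑ i, c i * pieceDeriv u r (x j - ((i : ℕ) : ℤ)) = 0) : c = 0 := by
  set Q : ℤ → ℝ → ℂ := translateSum u Finset.univ (fun i : Fin n => ((i : ℕ) : ℤ)) c with hQ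
  have hA : ∀ k : ℤ, ∃ A : ℕ → ℂ, (∀ x, Q k x =
      ∑ l ∈ Finset.range m, A l * (nestedIntegral w 1 l x : ℂ)) ∧
      ((k < 0 ∨ (n : ℤ) + m - 1 ≤ k) → A = 0) := by
    intro k
    by_cases hk : k < 0 ∨ (n : ℤ) + m - 1 ≤ k
    · refine ⟨0, fun x => ?_, fun _ => rfl⟩
      simp only [hQ, translateSum, Pi.zero_apply, zero_mul, Finset.sum_const_zero]
      refine Finset.sum_eq_zero fun i _ => ?_
      rw [P.eq_zero _ (by omega)]
      simp
    · obtain ⟨A, hA⟩ := exists_coeff_of_mem_eccSpace (P.translateSum_mem Finset.univ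
        (fun i : Fin n => ((i : ℕ) : ℤ)) c k)
      exact ⟨A, hA, fun h => absurd h hk⟩
  choose A hA hA0 using hA
  have hφQ : ∀ k : ℤ, ∀ x ∈ Ioo (k : ℝ) (k + 1),
      ∑ i, c i * φ (x - ((i : ℕ) : ℤ)) = Q k x := by
    intro k x hx
    exact Finset.sum_congr rfl fun i _ => by rw [P.comp_sub_eq hx]
  -- Sign changes only make sense for real functions; the cases L = re and L = im give the complex
  -- statement.
  have hL : ∀ L : ℂ →L[ℝ] ℝ, ∀ k, ∀ l < m, L (A k l) = 0 := by
    intro L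
    have hLQ : ∀ k, (fun x => L (Q k x)) = chainSum m w (fun l => L (A k l)) 0 := by
      intro k
      funext x
      rw [hA, map_sum, chainSum]
      refine Finset.sum_congr (by simp) fun l _ => ?_
      rw [mul_comm, ← Complex.real_smul, map_smul, smul_eq_mul, mul_comm]
      simp
    refine P.weights.spline_coeff_eq_zero (a := fun k l => L (A k l)) hm
      (h := fun x => L (∑ i, c i * φ (x - ((i : ℕ) : ℤ)))) (fun r hr => ?_) (fun k x hx => ?_)
      (n := n) (fun k hk l _ => by simp [hA0 k hk]) hx d hd hsum hxl hxr (fun j r hr => ?_)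
    · refine L.contDiff.comp (ContDiff.sum fun i _ => contDiff_const.mul ?_)
      exact (P.smooth r hr).comp (contDiff_id.sub contDiff_const)
    · simp only [hφQ k x hx, ← hLQ]
    · have hrm : r < m := hr.trans_lt (hd j)
      rw [← hLQ, iteratedDeriv_clm_comp L r
        (P.weights.contDiff_of_mem_eccSpace (P.translateSum_mem _ _ _ _) hrm)]
      beta_reduce
      rw [P.iteratedDeriv_translateSum _ _ _ hrm, h0 j r hr, map_zero]
  have hzero : ∀ k : ℤ, ∀ x ∈ Ioo (k : ℝ) (k + 1), ∑ i, c i * φ (x - ((i : ℕ) : ℤ)) = 0 := by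
    intro k x hx
    rw [hφQ k x hx, hA]
    refine Finset.sum_eq_zero fun l hl => ?_
    have hl := Finset.mem_range.1 hl
    rw [show A k l = 0 from Complex.ext (hL Complex.reCLM k l hl) (hL Complex.imCLM k l hl),
      zero_mul]
  obtain ⟨x₀, hx₀, hne⟩ := P.exists_ne
  -- At i + x₀ the later translates have not started and the earlier coefficients vanish by
  -- induction, so only c_i φ(x₀) remains.
  have hind : ∀ i : ℕ, ∀ hi : i < n, c ⟨i, hi⟩ = 0 := by
    intro i
    induction i using Nat.strong_induction_on with
    | _ i ih =>
      intro hi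
      have h1 := hzero i (i + x₀) ⟨by push_cast; linarith [hx₀.1], by push_cast; linarith [hx₀.2]⟩
      rw [Finset.sum_eq_single ⟨i, hi⟩] at h1
      · simpa [hne] using h1
      · intro j _ hj
        rcases lt_trichotomy (j : ℕ) i with h | h | h
        · rw [ih j h j.2, zero_mul]
        · exact absurd (Fin.ext h) hj
        · rw [P.comp_sub_eq (k := i), P.eq_zero _ (Or.inl (by omega))]
          · simp
          · exact ⟨by push_cast; linarith [hx₀.1], by push_cast; linarith [hx₀.2]⟩
      · simp
  funext i
  exact hind i i.2

theorem pieceDeriv_eq_zero (P : IsPieces m w φ u) (r : ℕ) {y : ℝ}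
    (hy : ⌊y⌋ < 0 ∨ m ≤ ⌊y⌋) : pieceDeriv u r y = 0 := by
  rw [pieceDeriv, P.eq_zero _ hy]
  exact iteratedDeriv_const_zero

theorem exists_norm_pieceDeriv_le (P : IsPieces m w φ u) :
    ∃ K : ℝ≥0, ∀ r < m, ∀ y, ‖pieceDeriv u r y‖₊ ≤ K := by
  have h : ∀ r, ∀ k : ℤ, ∃ C : ℝ≥0, r < m → ∀ y ∈ Icc (k : ℝ) (k + 1),
      ‖iteratedDeriv r (u k) y‖₊ ≤ C := by
    intro r k
    by_cases hr : r < m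
    · obtain ⟨C, hC⟩ := isCompact_Icc.exists_bound_of_continuousOn (s := Icc (k : ℝ) (k + 1))
        ((P.contDiff k hr).continuous_iteratedDeriv' r).continuousOn
      exact ⟨C.toNNReal, fun _ y hy => by
        rw [← NNReal.coe_le_coe]
        exact (hC y hy).trans (Real.le_coe_toNNReal C)⟩
    · exact ⟨0, fun h => absurd h hr⟩
  choose C hC using h
  refine ⟨∑ r ∈ Finset.range m, ∑ k ∈ Finset.Ico (0 : ℤ) m, C r k, fun r hr y => ?_⟩
  by_cases hy : ⌊y⌋ < 0 ∨ m ≤ ⌊y⌋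
  · rw [P.pieceDeriv_eq_zero r hy]
    simp
  · refine (hC r ⌊y⌋ hr y ⟨Int.floor_le y, (Int.lt_floor_add_one y).le⟩).trans ?_
    refine (Finset.single_le_sum (f := fun k => C r k) (fun _ _ => zero_le)
      (Finset.mem_Ico.2 (by omega : 0 ≤ ⌊y⌋ ∧ ⌊y⌋ < m))).trans ?_
    exact Finset.single_le_sum (f := fun r => ∑ k ∈ Finset.Ico (0 : ℤ) m, C r k)
      (fun _ _ => zero_le) (Finset.mem_range.2 hr)

/-- Up to order m - 2 this is the ordinary derivative of φ; order m - 1 may jump at integers, which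
are therefore excluded. -/
theorem continuousAt_pieceDeriv (P : IsPieces m w φ u) {r : ℕ} (hr : r < m) {y : ℝ}
    (hy : r + 2 ≤ m ∨ (⌊y⌋ : ℝ) < y) : ContinuousAt (pieceDeriv u r) y := by
  rcases hy with hy | hy
  · have hc := (P.smooth r hy).continuous_iteratedDeriv' r
    have : iteratedDeriv r φ = pieceDeriv u r := by
      funext x
      have h1 : EqOn (iteratedDeriv r φ) (iteratedDeriv r (u ⌊x⌋)) (Ioo (⌊x⌋ : ℝ) (⌊x⌋ + 1)) := by
        intro z hz
        refine Filter.EventuallyEq.iteratedDeriv_eq r ?_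
        filter_upwards [isOpen_Ioo.mem_nhds hz] with t ht using P.eqOn _ ht
      exact h1.of_subset_closure (t := Icc (⌊x⌋ : ℝ) (⌊x⌋ + 1)) hc.continuousOn
        ((P.contDiff _ hr).continuous_iteratedDeriv' r).continuousOn Ioo_subset_Icc_self
        (by rw [closure_Ioo (by simp)]) ⟨Int.floor_le x, (Int.lt_floor_add_one x).le⟩
    rw [← this]
    exact hc.continuousAt
  · refine ((P.contDiff ⌊y⌋ hr).continuous_iteratedDeriv' r).continuousAt.congr ?_
    filter_upwards [Ioo_mem_nhds hy (Int.lt_floor_add_one y)] with z hz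
    rw [pieceDeriv, Int.floor_eq_iff.2 ⟨hz.1.le, hz.2⟩]

/-- Knots are left out because for m = 1 the value of φ at an integer is not tied to the pieces. -/
theorem tsum_eq (P : IsPieces m w φ u) (c : ℤ → ℂ) {k : ℤ} {x : ℝ}
    (hx : x ∈ Ioo (k : ℝ) (k + 1)) :
    ∑' l : ℤ, c l * φ (x - l) = translateSum u (Finset.Ioc (k - m) k) id c k x := by
  rw [tsum_eq_sum (s := Finset.Ioc (k - m) k), translateSum]
  · exact Finset.sum_congr rfl fun l _ => by rw [P.comp_sub_eq hx]; rfl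
  · intro l hl
    rw [Finset.mem_Ioc] at hl
    rw [P.comp_sub_eq hx, P.eq_zero _ (by omega)]
    simp

/-- Between x and the next integer the series is one smooth piece, whose derivative at x is the
right-sided limit. -/
theorem hasSampleValue (P : IsPieces m w φ u) (c : ℤ → ℂ) {s : ℕ} (hs : s < m) (x : ℝ) :
    HasSampleValue (fun x => ∑' l : ℤ, c l * φ (x - l)) s x ∧
      sampleValue (fun x => ∑' l : ℤ, c l * φ (x - l)) s x =
        ∑ l ∈ Finset.Ioc (⌊x⌋ - (m : ℤ)) ⌊x⌋, c l * pieceDeriv u s (x - l) := by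
  set Q := translateSum u (Finset.Ioc (⌊x⌋ - (m : ℤ)) ⌊x⌋) id c ⌊x⌋ with hQ
  have hQc : ContDiff ℝ (s : WithTop ℕ∞) Q :=
    P.weights.contDiff_of_mem_eccSpace (P.translateSum_mem _ _ _ _) hs
  have hsub : Ioo x (⌊x⌋ + 1) ⊆ Ioo (⌊x⌋ : ℝ) (⌊x⌋ + 1) :=
    Ioo_subset_Ioo_left (Int.floor_le x)
  have heq : EqOn (fun x => ∑' l : ℤ, c l * φ (x - l)) Q (Ioo x (⌊x⌋ + 1)) :=
    fun y hy => P.tsum_eq c (hsub hy)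
  have hlim : Tendsto (iteratedDeriv s (fun x => ∑' l : ℤ, c l * φ (x - l))) (𝓝[>] x)
      (𝓝 (iteratedDeriv s Q x)) := by
    refine ((hQc.continuous_iteratedDeriv' s).continuousAt.continuousWithinAt.tendsto).congr' ?_
    filter_upwards [Ioo_mem_nhdsGT (Int.lt_floor_add_one x)] with y hy
    refine (Filter.EventuallyEq.iteratedDeriv_eq s ?_).symm
    filter_upwards [isOpen_Ioo.mem_nhds hy] with t ht using heq ht
  refine ⟨⟨⟨⌊x⌋ + 1 - x, by linarith [Int.lt_floor_add_one x], ?_⟩, _, hlim⟩, ?_⟩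
  · rw [add_sub_cancel]
    exact hQc.contDiffOn.congr heq
  · rw [sampleValue, hlim.limUnder_eq]
    exact P.iteratedDeriv_translateSum _ _ _ hs x

end IsPieces

/-! ### Uniform local estimates by compactness -/

namespace IsPieces

variable {m : ℕ} {w : ℕ → ℝ → ℝ} {φ : ℝ → ℂ} {u : ℤ → ℝ → ℂ}

/-- For a fixed pattern of multiplicities, the coefficients depend on the samples in a bounded way,
uniformly over all separated sampling points that are interlaced with margin `ε`. -/
theorem exists_bound_of_pattern (P : IsPieces m w φ u) (hm : 1 ≤ m) {ε δ : ℝ} (hε : 0 < ε)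
    (hδ : 0 < δ) {N n : ℕ} (d : Fin N → ℕ) (hd : ∀ j, d j < m) (hsum : ∑ j, (1 + d j) = n) :
    ∃ C : ℝ, 0 ≤ C ∧ ∀ x : Fin N → ℝ, (∀ i j, i < j → δ ≤ x j - x i) →
      (∀ j, (d j : ℝ) + ε + (∑ r ∈ Finset.Iio j, (1 + d r) : ℕ) ≤ x j) →
      (∀ j, x j ≤ m - ε + (∑ r ∈ Finset.Iio j, (1 + d r) : ℕ)) → ∀ c : Fin n → ℂ,
      ‖c‖ ≤ C * ∑ j, ∑ r ∈ Finset.range (d j + 1),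
        ‖∑ i, c i * pieceDeriv u r (x j - ((i : ℕ) : ℤ))‖ := by
  set σ : Fin N → ℕ := fun j => ∑ r ∈ Finset.Iio j, (1 + d r) with hσ
  set F : (Fin N → ℝ) × (Fin n → ℂ) → ℝ := fun z => ∑ j, ∑ r ∈ Finset.range (d j + 1),
    ‖∑ i, z.2 i * pieceDeriv u r (z.1 j - ((i : ℕ) : ℤ))‖ with hF
  set K : Set (Fin N → ℝ) := {x | (∀ i j, i < j → δ ≤ x j - x i) ∧
    (∀ j, (d j : ℝ) + ε + σ j ≤ x j) ∧ ∀ j, x j ≤ m - ε + σ j} with hK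
  have hKc : IsCompact K := by
    refine (isCompact_univ_pi (s := fun j => Icc ((d j : ℝ) + ε + σ j) (m - ε + σ j))
      fun _ => isCompact_Icc).of_isClosed_subset ?_ ?_
    · simp only [hK, ofPred_and, ofPred_forall]
      refine IsClosed.inter ?_ (IsClosed.inter ?_ ?_)
      · refine isClosed_iInter fun i => isClosed_iInter fun j => isClosed_iInter fun _ => ?_
        exact isClosed_le (by fun_prop) (by fun_prop)
      · exact isClosed_iInter fun j => isClosed_le (by fun_prop) (by fun_prop)
      · exact isClosed_iInter fun j => isClosed_le (by fun_prop) (by fun_prop)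
    · exact fun x hx j _ => ⟨hx.2.1 j, hx.2.2 j⟩
  have hTc : IsCompact (K ×ˢ Metric.sphere (0 : Fin n → ℂ) 1) := hKc.prod (isCompact_sphere _ _)
  have hFc : ContinuousOn F (K ×ˢ Metric.sphere (0 : Fin n → ℂ) 1) := by
    intro z hz
    refine ContinuousAt.continuousWithinAt ?_
    refine tendsto_finsetSum _ fun j _ => tendsto_finsetSum _ fun r hr => ?_
    refine (tendsto_finsetSum _ fun i _ => ?_).norm
    have hrd : r ≤ d j := Nat.lt_succ_iff.1 (Finset.mem_range.1 hr)
    have hdm := hd j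
    refine Tendsto.mul ?_ ?_
    · exact ((continuous_apply i).comp continuous_snd).continuousAt
    · have h1 : ContinuousAt (pieceDeriv u r) (z.1 j - ((i : ℕ) : ℤ)) := by
        refine P.continuousAt_pieceDeriv (by omega) ?_
        -- If r = m - 1 then d j = m - 1, and the margin ε confines the node to the interior of a
        -- single knot interval, away from the jumps.
        by_cases hr2 : r + 2 ≤ m
        · exact Or.inl hr2
        · refine Or.inr (lt_of_le_of_ne (Int.floor_le _) fun heq => ?_)
          have hdj : (d j : ℝ) = m - 1 := by
            have : d j + 1 = m := by omega
            rw [← this]; push_cast; ring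
          have h2 := hz.1.2.1 j
          have h3 := hz.1.2.2 j
          set q := ⌊z.1 j - ((i : ℕ) : ℤ)⌋
          have hzq : z.1 j = ((q + (i : ℕ) : ℤ) : ℝ) := by push_cast at heq ⊢; linarith
          rw [hzq] at h2 h3
          have h4 : (((m : ℤ) - 1 + σ j : ℤ) : ℝ) < ((q + (i : ℕ) : ℤ) : ℝ) := by
            rw [hdj] at h2
            push_cast at h2 ⊢; linarith
          have h5 : ((q + (i : ℕ) : ℤ) : ℝ) < (((m : ℤ) + σ j : ℤ) : ℝ) := by
            push_cast at h3 ⊢; linarith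
          have h4' := Int.cast_lt.1 h4
          have h5' := Int.cast_lt.1 h5
          omega
      have h2 : ContinuousAt (fun z : (Fin N → ℝ) × (Fin n → ℂ) => z.1 j - ((i : ℕ) : ℤ)) z := by
        fun_prop
      exact ContinuousAt.comp (f := fun z : (Fin N → ℝ) × (Fin n → ℂ) => z.1 j - ((i : ℕ) : ℤ))
        h1 h2
  -- Schoenberg–Whitney says that F vanishes only for c = 0; its minimum over the compact set then
  -- gives the constant, and homogeneity in c removes the normalisation.
  have hpos : ∀ z ∈ K ×ˢ Metric.sphere (0 : Fin n → ℂ) 1, 0 < F z := by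
    rintro ⟨x, c⟩ ⟨hx, hc⟩
    refine lt_of_le_of_ne (Finset.sum_nonneg fun j _ => Finset.sum_nonneg fun r _ =>
      norm_nonneg _) fun h0 => ?_
    have hc0 : c = 0 := by
      refine P.coeff_eq_zero hm (x := x) (fun i j hij => by linarith [hx.1 i j hij]) d hd hsum
        (fun j => by have := hx.2.1 j; simp only [hσ] at this; linarith)
        (fun j => by have := hx.2.2 j; simp only [hσ] at this; linarith) c fun j r hr => ?_
      have h1 := (Finset.sum_eq_zero_iff_of_nonneg (fun j _ => Finset.sum_nonneg fun r _ =>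
        norm_nonneg _)).1 h0.symm j (Finset.mem_univ _)
      have h2 := (Finset.sum_eq_zero_iff_of_nonneg (fun r _ =>
        norm_nonneg _)).1 h1 r (Finset.mem_range.2 (by omega))
      exact norm_eq_zero.1 h2
    simp [hc0] at hc
  have hhom : ∀ (t : ℝ) (x : Fin N → ℝ) (c : Fin n → ℂ), 0 ≤ t → F (x, t • c) = t * F (x, c) := by
    intro t x c ht
    simp only [hF, Finset.mul_sum]
    refine Finset.sum_congr rfl fun j _ => Finset.sum_congr rfl fun r _ => ?_
    rw [← abs_of_nonneg ht, ← Real.norm_eq_abs, ← norm_smul, Finset.smul_sum,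
      Real.norm_of_nonneg ht]
    simp [mul_assoc]
  rcases (K ×ˢ Metric.sphere (0 : Fin n → ℂ) 1).eq_empty_or_nonempty with hemp | hne
  · refine ⟨0, le_rfl, fun x h1 h2 h3 c => ?_⟩
    by_contra hc
    rw [zero_mul, not_le, norm_pos_iff] at hc
    have : (x, ‖c‖⁻¹ • c) ∈ K ×ˢ Metric.sphere (0 : Fin n → ℂ) 1 :=
      ⟨⟨h1, h2, h3⟩, by simp [norm_smul, hc]⟩
    rw [hemp] at this
    exact this
  · obtain ⟨z, hz, hmin⟩ := hTc.exists_isMinOn hne hFc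
    refine ⟨(F z)⁻¹, inv_nonneg.2 (hpos z hz).le, fun x h1 h2 h3 c => ?_⟩
    change ‖c‖ ≤ (F z)⁻¹ * F (x, c)
    rcases eq_or_ne c 0 with rfl | hc
    · have := hhom 0 x 0 le_rfl
      simp only [smul_zero, zero_mul] at this
      simp [this]
    · have hm' : (x, ‖c‖⁻¹ • c) ∈ K ×ˢ Metric.sphere (0 : Fin n → ℂ) 1 :=
        ⟨⟨h1, h2, h3⟩, by simp [norm_smul, hc]⟩
      have h4 : F z ≤ F (x, ‖c‖⁻¹ • c) := hmin hm'
      rw [hhom _ _ _ (by positivity)] at h4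
      have hcp := norm_pos_iff.2 hc
      rw [inv_mul_eq_div, le_div_iff₀ hcp] at h4
      rw [inv_mul_eq_div, le_div_iff₀ (hpos z hz), mul_comm]
      exact h4

/-- The total n bounds both the number of nodes and each multiplicity, so there are finitely many
patterns and their constants can be summed. -/
theorem exists_uniform_bound (P : IsPieces m w φ u) (hm : 1 ≤ m) {ε δ : ℝ} (hε : 0 < ε)
    (hδ : 0 < δ) (n : ℕ) : ∃ C : ℝ, 0 ≤ C ∧ ∀ (N : ℕ) (x : Fin N → ℝ) (d : Fin N → ℕ),
      (∀ i j, i < j → δ ≤ x j - x i) → (∀ j, d j < m) → ∑ j, (1 + d j) = n →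
      (∀ j, (d j : ℝ) + ε + (∑ r ∈ Finset.Iio j, (1 + d r) : ℕ) ≤ x j) →
      (∀ j, x j ≤ m - ε + (∑ r ∈ Finset.Iio j, (1 + d r) : ℕ)) → ∀ c : Fin n → ℂ,
      ‖c‖ ≤ C * ∑ j, ∑ r ∈ Finset.range (d j + 1),
        ‖∑ i, c i * pieceDeriv u r (x j - ((i : ℕ) : ℤ))‖ := by
  have h : ∀ z : (N : Fin (n + 1)) × (Fin N → Fin (n + 1)), ∃ C : ℝ, 0 ≤ C ∧
      ((∀ j, (z.2 j : ℕ) < m) → ∑ j, (1 + (z.2 j : ℕ)) = n → ∀ x : Fin z.1 → ℝ,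
      (∀ i j, i < j → δ ≤ x j - x i) →
      (∀ j, ((z.2 j : ℕ) : ℝ) + ε + (∑ r ∈ Finset.Iio j, (1 + (z.2 r : ℕ)) : ℕ) ≤ x j) →
      (∀ j, x j ≤ m - ε + (∑ r ∈ Finset.Iio j, (1 + (z.2 r : ℕ)) : ℕ)) → ∀ c : Fin n → ℂ,
      ‖c‖ ≤ C * ∑ j, ∑ r ∈ Finset.range ((z.2 j : ℕ) + 1),
        ‖∑ i, c i * pieceDeriv u r (x j - ((i : ℕ) : ℤ))‖) := by
    rintro ⟨N, d⟩
    by_cases hc : (∀ j, (d j : ℕ) < m) ∧ ∑ j, (1 + (d j : ℕ)) = n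
    · obtain ⟨C, hC0, hC⟩ := P.exists_bound_of_pattern hm hε hδ (fun j => (d j : ℕ)) hc.1 hc.2
      exact ⟨C, hC0, fun _ _ => hC⟩
    · exact ⟨0, le_rfl, fun h1 h2 => absurd ⟨h1, h2⟩ hc⟩
  choose C hC0 hC using h
  refine ⟨∑ z, C z, Finset.sum_nonneg fun z _ => hC0 z, fun N x d hx hd hsum hl hr c => ?_⟩
  have hN : N < n + 1 := by
    have : ∑ _j : Fin N, 1 ≤ ∑ j, (1 + d j) := Finset.sum_le_sum fun j _ => by omega
    simp only [Finset.sum_const, Finset.card_univ, Fintype.card_fin, smul_eq_mul, mul_one] at this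
    omega
  have hdn : ∀ j, d j < n + 1 := by
    intro j
    have := Finset.single_le_sum (f := fun j => 1 + d j) (fun _ _ => Nat.zero_le _)
      (Finset.mem_univ j)
    omega
  refine (hC ⟨⟨N, hN⟩, fun j => ⟨d j, hdn j⟩⟩ hd hsum x hx hl hr c).trans ?_
  exact mul_le_mul_of_nonneg_right (Finset.single_le_sum (fun z _ => hC0 z) (Finset.mem_univ _))
    (Finset.sum_nonneg fun j _ => Finset.sum_nonneg fun r _ => norm_nonneg _)

end IsPieces

/-! ### Comparison of `ℓ^p`-norms -/

/-- The `ℓ^p`-norm of a family in `[0, ∞]`. -/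
noncomputable def lpENorm {ι : Type*} (p : ℝ≥0∞) (a : ι → ℝ≥0∞) : ℝ≥0∞ :=
  if p = ∞ then ⨆ i, a i else (∑' i, a i ^ p.toReal) ^ (1 / p.toReal)

theorem one_le_toReal {p : ℝ≥0∞} (hp : 1 ≤ p) (hp' : p ≠ ∞) : 1 ≤ p.toReal := by
  simpa using ENNReal.toReal_mono hp' hp

/-- A family which is dominated by another one along a map with finite fibres of bounded size. -/
theorem lpENorm_le_of_le_comp {ι κ : Type*} {p : ℝ≥0∞} (hp : 1 ≤ p) {a : ι → ℝ≥0∞}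
    {b : κ → ℝ≥0∞} (g : ι → κ) {C : ℝ≥0∞} {n : ℕ} (hn : 1 ≤ n) (h : ∀ i, a i ≤ C * b (g i))
    (hfib : ∀ j, (g ⁻¹' {j}).encard ≤ n) : lpENorm p a ≤ C * n * lpENorm p b := by
  have hn' : (1 : ℝ≥0∞) ≤ n := by exact_mod_cast hn
  by_cases hpt : p = ∞
  · simp only [lpENorm, if_pos hpt]
    refine iSup_le fun i => (h i).trans ?_
    gcongr
    · exact le_mul_of_one_le_right (zero_le) hn'
    · exact le_iSup b (g i)
  · simp only [lpENorm, if_neg hpt]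
    have hp1 := one_le_toReal hp hpt
    set q := p.toReal with hq
    have hq0 : 0 < q := by linarith
    have h1 : ∑' i, a i ^ q ≤ (C * n) ^ q * ∑' j, b j ^ q := by
      calc ∑' i, a i ^ q ≤ ∑' i, C ^ q * b (g i) ^ q := by
            refine ENNReal.tsum_le_tsum fun i => ?_
            rw [← ENNReal.mul_rpow_of_nonneg _ _ hq0.le]
            exact ENNReal.rpow_le_rpow (h i) hq0.le
        _ = C ^ q * ∑' j, ((g ⁻¹' {j}).encard : ℝ≥0∞) * b j ^ q := by
            rw [ENNReal.tsum_mul_left]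
            congr 1
            rw [← (Equiv.sigmaFiberEquiv g).tsum_eq, ENNReal.tsum_sigma']
            refine tsum_congr fun j => ?_
            rw [← ENNReal.tsum_set_const]
            refine tsum_congr fun x => ?_
            change b (g x.1) ^ q = _
            rw [show g x.1 = j from x.2]
        _ ≤ C ^ q * ∑' j, (n : ℝ≥0∞) ^ q * b j ^ q := by
            gcongr with j
            calc ((g ⁻¹' {j}).encard : ℝ≥0∞) ≤ ((n : ℕ∞) : ℝ≥0∞) :=
                  ENat.toENNReal_le.2 (hfib j)
              -- Using n ≤ n^q for q ≥ 1 trades n^(1/q) for n and keeps the constant free of p.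
              _ = (n : ℝ≥0∞) ^ (1 : ℝ) := by simp
              _ ≤ (n : ℝ≥0∞) ^ q := ENNReal.rpow_le_rpow_of_exponent_le hn' hp1
        _ = _ := by
            rw [ENNReal.tsum_mul_left, ← mul_assoc, ENNReal.mul_rpow_of_nonneg _ _ hq0.le]
    calc (∑' i, a i ^ q) ^ (1 / q) ≤ ((C * n) ^ q * ∑' j, b j ^ q) ^ (1 / q) :=
          ENNReal.rpow_le_rpow h1 (by positivity)
      _ = _ := by
          rw [ENNReal.mul_rpow_of_nonneg _ _ (by positivity), ← ENNReal.rpow_mul,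
            mul_one_div_cancel hq0.ne', ENNReal.rpow_one]

theorem sampleNorm_eq_lpENorm (X : Set ℝ) (μ : ℝ → ℕ) (p : ℝ≥0∞) (f : ℝ → ℂ) :
    sampleNorm X μ p f =
      lpENorm p (fun z : (x : X) × Fin (μ x + 1) => ‖sampleValue f z.2 z.1‖ₑ) := by
  unfold sampleNorm lpENorm
  split_ifs with hp
  · rw [iSup_sigma, iSup_subtype']
    refine iSup_congr fun x => ?_
    refine le_antisymm (iSup₂_le fun s hs => ?_) (iSup_le fun s => ?_)
    · exact le_iSup (fun s : Fin (μ x + 1) => ‖sampleValue f s x‖ₑ) ⟨s, Finset.mem_range.1 hs⟩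
    · exact le_iSup₂ (f := fun s (_ : s ∈ Finset.range (μ x + 1)) => ‖sampleValue f s x‖ₑ)
        (s : ℕ) (Finset.mem_range.2 s.2)
  · rw [ENNReal.tsum_sigma']
    congr 1
    refine tsum_congr fun x => ?_
    rw [tsum_fintype, Finset.sum_range]

theorem restrict_iUnion_Ioo_int :
    (volume : Measure ℝ).restrict (⋃ k : ℤ, Ioo (k : ℝ) (k + 1)) = volume := by
  have : (⋃ k : ℤ, Ioo (k : ℝ) (k + 1)) =ᵐ[volume] (univ : Set ℝ) := by
    have h : ∀ᵐ x : ℝ, x ∉ range ((↑) : ℤ → ℝ) := (countable_range _).ae_notMem _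
    filter_upwards [h] with x hx
    refine propext ⟨fun _ => trivial, fun _ => mem_iUnion.2 ⟨⌊x⌋, ?_, Int.lt_floor_add_one x⟩⟩
    exact lt_of_le_of_ne (Int.floor_le x) fun h => hx ⟨_, h⟩
  rw [Measure.restrict_congr_set this, Measure.restrict_univ]

theorem pairwise_disjoint_Ioo_int :
    Pairwise (Function.onFun Disjoint fun k : ℤ => Ioo (k : ℝ) (k + 1)) := by
  intro k l hkl
  refine disjoint_left.2 fun x hk hl => hkl ?_
  rw [← Int.floor_eq_iff.2 ⟨hk.1.le, hk.2⟩, ← Int.floor_eq_iff.2 ⟨hl.1.le, hl.2⟩]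

/-- The knots are a null set, so L^p norms reduce to `ℓ^p`-norms of local norms on unit intervals.
-/
theorem eLpNorm_eq_lpENorm {p : ℝ≥0∞} (hp : 1 ≤ p) (f : ℝ → ℂ) :
    eLpNorm f p volume =
      lpENorm p (fun k : ℤ => eLpNorm f p (volume.restrict (Ioo (k : ℝ) (k + 1)))) := by
  have hp0 : p ≠ 0 := (zero_lt_one.trans_le hp).ne'
  unfold lpENorm
  split_ifs with hpt
  · refine le_antisymm ?_ (iSup_le fun k => eLpNorm_mono_measure _ Measure.restrict_le_self)
    subst hpt
    simp only [eLpNorm_exponent_top]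
    have hle := le_iSup fun k : ℤ => eLpNormEssSup f (volume.restrict (Ioo (k : ℝ) (k + 1)))
    generalize (⨆ k : ℤ, eLpNormEssSup f (volume.restrict (Ioo (k : ℝ) (k + 1)))) = S at hle ⊢
    refine essSup_le_of_ae_le _ ?_
    rw [EventuallyLE, ← restrict_iUnion_Ioo_int, ae_restrict_iUnion_iff]
    intro k
    filter_upwards [ae_le_eLpNormEssSup (f := f)
      (μ := volume.restrict (Ioo (k : ℝ) (k + 1)))] with x hx
    exact hx.trans (hle k)
  · have hq0 : 0 < p.toReal := by linarith [one_le_toReal hp hpt]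
    rw [eLpNorm_eq_lintegral_rpow_enorm_toReal hp0 hpt]
    congr 1
    conv_lhs => rw [← restrict_iUnion_Ioo_int]
    rw [lintegral_iUnion (fun _ => measurableSet_Ioo) pairwise_disjoint_Ioo_int]
    refine tsum_congr fun k => ?_
    beta_reduce
    rw [eLpNorm_eq_lintegral_rpow_enorm_toReal hp0 hpt, ← ENNReal.rpow_mul,
      one_div_mul_cancel hq0.ne', ENNReal.rpow_one]

theorem lpENorm_lt_top_of_memℓp {p : ℝ≥0∞} (hp : 1 ≤ p) {c : ℤ → ℂ} (hc : Memℓp c p) :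
    lpENorm p (fun l => ‖c l‖ₑ) < ∞ := by
  unfold lpENorm
  split_ifs with hpt
  · subst hpt
    obtain ⟨C, hC⟩ := memℓp_infty_iff.1 hc
    refine (iSup_le fun l => ?_).trans_lt (ENNReal.ofReal_lt_top (r := C))
    beta_reduce
    rw [← ofReal_norm]
    exact ENNReal.ofReal_le_ofReal (hC ⟨l, rfl⟩)
  · have hq0 : 0 < p.toReal := by linarith [one_le_toReal hp hpt]
    have hs := (memℓp_gen_iff hq0).1 hc
    refine ENNReal.rpow_lt_top_of_nonneg (by positivity) ?_
    have : ∀ l, ‖c l‖ₑ ^ p.toReal = ENNReal.ofReal (‖c l‖ ^ p.toReal) := fun l => by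
      rw [← ofReal_norm, ENNReal.ofReal_rpow_of_nonneg (norm_nonneg _) hq0.le]
    simp_rw [this]
    rw [← ENNReal.ofReal_tsum_of_nonneg (fun l => by positivity) hs]
    exact ENNReal.ofReal_ne_top

/-- The right-sided `r`-th derivative at `x` of the combination of integer translates with
coefficients `c`. -/
noncomputable def sampleSum (m : ℕ) (u : ℤ → ℝ → ℂ) (c : ℤ → ℂ) (r : ℕ) (x : ℝ) : ℂ :=
  ∑ l ∈ Finset.Ioc (⌊x⌋ - (m : ℤ)) ⌊x⌋, c l * pieceDeriv u r (x - l)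

/-- Among the m active coefficients one dominates, which puts the upper bounds in the form required
by `lpENorm_le_of_le_comp`. -/
theorem exists_forall_norm_le {m : ℕ} (hm : 1 ≤ m) (c : ℤ → ℂ) (k : ℤ) :
    ∃ g ∈ Finset.Ioc (k - (m : ℤ)) k, ∀ l ∈ Finset.Ioc (k - (m : ℤ)) k, ‖c l‖₊ ≤ ‖c g‖₊ :=
  Finset.exists_max_image _ _ ⟨k, Finset.mem_Ioc.2 (by omega)⟩

theorem nnnorm_sampleSum_le {m : ℕ} {u : ℤ → ℝ → ℂ} {K : ℝ≥0} {r : ℕ}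
    (hK : ∀ y, ‖pieceDeriv u r y‖₊ ≤ K) {c : ℤ → ℂ} {x : ℝ} {g : ℤ}
    (hg : ∀ l ∈ Finset.Ioc (⌊x⌋ - (m : ℤ)) ⌊x⌋, ‖c l‖₊ ≤ ‖c g‖₊) :
    ‖sampleSum m u c r x‖₊ ≤ m * K * ‖c g‖₊ := by
  refine (nnnorm_sum_le _ _).trans ?_
  refine (Finset.sum_le_card_nsmul _ _ (K * ‖c g‖₊) fun l hl => ?_).trans ?_
  · rw [nnnorm_mul, mul_comm]
    exact mul_le_mul' (hK _) (hg l hl)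
  · simp [mul_assoc]

theorem enorm_le_of_nnnorm_le {a b : ℂ} {C : ℝ≥0} (h : ‖a‖₊ ≤ C * ‖b‖₊) :
    ‖a‖ₑ ≤ (C : ℝ≥0∞) * ‖b‖ₑ := by
  rw [enorm_eq_nnnorm, enorm_eq_nnnorm, ← ENNReal.coe_mul]
  exact ENNReal.coe_le_coe.2 h

/-- The added 1 makes the constant positive even if C or D is 0. -/
theorem le_coe_mul_of_le_mul {x y z : ℝ≥0∞} {C D : ℝ≥0} (h : x ≤ C * y) (h' : y ≤ D * z) :
    x ≤ (C * D + 1 : ℝ≥0) * z := by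
  calc x ≤ C * (D * z) := h.trans (mul_le_mul' le_rfl h')
    _ = (C * D : ℝ≥0) * z := by rw [← mul_assoc, ← ENNReal.coe_mul]
    _ ≤ _ := mul_le_mul' (ENNReal.coe_le_coe.2 le_self_add) le_rfl

/-! ### The four inequalities between coefficients, samples and functions -/

namespace IsPieces

variable {m : ℕ} {w : ℕ → ℝ → ℝ} {φ : ℝ → ℂ} {u : ℤ → ℝ → ℂ}

theorem tsum_eq_sampleSum (P : IsPieces m w φ u) (hm : 1 ≤ m) (c : ℤ → ℂ) {k : ℤ} {x : ℝ}
    (hx : x ∈ Ioo (k : ℝ) (k + 1)) : ∑' l : ℤ, c l * φ (x - l) = sampleSum m u c 0 x := by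
  have hk : ⌊x⌋ = k := Int.floor_eq_iff.2 ⟨hx.1.le, hx.2⟩
  have := P.iteratedDeriv_translateSum (Finset.Ioc (k - (m : ℤ)) k) id c (r := 0) (by omega) x
  rw [P.tsum_eq c hx, sampleSum, hk]
  rwa [iteratedDeriv_zero, hk] at this

theorem continuousOn_tsum (P : IsPieces m w φ u) (hm : 1 ≤ m) (c : ℤ → ℂ) (k : ℤ) :
    ContinuousOn (fun x : ℝ => ∑' l : ℤ, c l * φ (x - l)) (Ioo (k : ℝ) (k + 1)) :=
  (P.weights.contDiff_of_mem_eccSpace (P.translateSum_mem _ id c k)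
    (show 0 < m by omega)).continuous.continuousOn.congr fun _ hx => P.tsum_eq c hx

theorem aestronglyMeasurable_tsum (P : IsPieces m w φ u) (hm : 1 ≤ m) (c : ℤ → ℂ) :
    AEStronglyMeasurable (fun x : ℝ => ∑' l : ℤ, c l * φ (x - l)) volume := by
  rw [← restrict_iUnion_Ioo_int, aestronglyMeasurable_iUnion_iff]
  exact fun k => (P.continuousOn_tsum hm c k).aestronglyMeasurable measurableSet_Ioo

/-- Every coefficient with index in a block is controlled by one of the samples in the block. -/
theorem exists_block_bound (P : IsPieces m w φ u) (hm : 1 ≤ m) {ε δ : ℝ} (hε : 0 < ε)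
    (hδ : 0 < δ) {L : ℕ} (hL : 0 < L) : ∃ C : ℝ≥0, ∀ (c : ℤ → ℂ) (a : ℤ) (N : ℕ)
      (x : Fin N → ℝ) (d : Fin N → ℕ), (∀ j, x j ∈ Ico (a : ℝ) (a + L)) →
      (∀ i j, i < j → δ ≤ x j - x i) → (∀ j, d j < m) → ∑ j, (1 + d j) = L + m - 1 →
      (∀ j, x j ∈ Icc (((d j : ℝ) - m + ε) + (a + 1 + ∑ n ∈ Finset.Iio j, (1 + (d n : ℝ))))
        (-ε + (a + 1 + ∑ n ∈ Finset.Iio j, (1 + (d n : ℝ))))) →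
      ∀ l, a ≤ l → l < a + L → ∃ j, ∃ r ≤ d j, ‖c l‖₊ ≤ C * ‖sampleSum m u c r (x j)‖₊ := by
  obtain ⟨C, hC0, hC⟩ := P.exists_uniform_bound hm hε hδ (L + m - 1)
  refine ⟨C.toNNReal * ((L + m - 1 : ℕ) : ℝ≥0), fun c a N x d hx hsep hd hsum hint l hl hl' => ?_⟩
  set n := L + m - 1 with hn
  -- b is the first index whose translate reaches the block. Shifting by b turns the interlacing
  -- condition into d j + ε + σ ≤ x ≤ m - ε + σ, where σ is the sum of the earlier 1 + d.
  set b : ℤ := a - m + 1 with hb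
  have hbR : (b : ℝ) = a - m + 1 := by rw [hb]; push_cast; ring
  have key := hC N (fun j => x j - b) d (fun i j hij => by linarith [hsep i j hij]) hd hsum
    (fun j => by have := (hint j).1; push_cast; rw [hbR]; linarith)
    (fun j => by have := (hint j).2; push_cast; rw [hbR]; linarith)
    (fun i => c (b + (i : ℕ)))
  have hS : ∀ j r, ∑ i : Fin n, c (b + (i : ℕ)) * pieceDeriv u r (x j - b - ((i : ℕ) : ℤ)) =
      sampleSum m u c r (x j) := by
    intro j r
    have hf1 : a ≤ ⌊x j⌋ := Int.le_floor.2 (hx j).1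
    have hf2 : ⌊x j⌋ < a + L := Int.floor_lt.2 (by push_cast; exact (hx j).2)
    rw [Fin.sum_univ_eq_sum_range
      (fun i => c (b + (i : ℕ)) * pieceDeriv u r (x j - b - ((i : ℕ) : ℤ))) n, sampleSum]
    symm
    refine Finset.sum_of_injOn (fun l => (l - b).toNat) ?_ ?_ ?_ ?_
    · intro l hl l' hl' h
      have h1 := Finset.mem_Ioc.1 (Finset.mem_coe.1 hl)
      have h2 := Finset.mem_Ioc.1 (Finset.mem_coe.1 hl')
      simp only at h
      omega
    · intro l hl
      have h1 := Finset.mem_Ioc.1 (Finset.mem_coe.1 hl)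
      simp only [Finset.coe_range, mem_Iio]
      omega
    · intro i hi hi'
      rw [P.pieceDeriv_eq_zero, mul_zero]
      have : x j - b - ((i : ℕ) : ℤ) = x j - ((b + (i : ℕ) : ℤ) : ℝ) := by push_cast; ring
      rw [this, Int.floor_sub_intCast]
      by_contra! hcon
      refine hi' ⟨b + i, Finset.mem_coe.2 (Finset.mem_Ioc.2 (by omega)), ?_⟩
      simp
    · intro l hl
      have h1 := Finset.mem_Ioc.1 hl
      have h2 : (((l - b).toNat : ℕ) : ℤ) = l - b := Int.toNat_of_nonneg (by omega)
      simp only [h2]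
      rw [show b + (l - b) = l by ring]
      congr 2
      push_cast; ring
  simp only [hS] at key
  set T : Finset ((_ : Fin N) × ℕ) := Finset.univ.sigma fun j => Finset.range (d j + 1) with hT
  have hcard : T.card = n := by
    rw [hT, Finset.card_sigma, ← hsum]
    exact Finset.sum_congr rfl fun j _ => by rw [Finset.card_range, add_comm]
  have hTne : T.Nonempty := by
    rw [← Finset.card_pos, hcard]; omega
  -- The sum of the n samples is at most n times the largest, so a single sample controls every
  -- coefficient.
  obtain ⟨z, hz, hmax⟩ := T.exists_max_image (fun z => ‖sampleSum m u c z.2 (x z.1)‖) hTne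
  refine ⟨z.1, z.2, Nat.lt_succ_iff.1 (Finset.mem_range.1 (Finset.mem_sigma.1 hz).2), ?_⟩
  rw [← NNReal.coe_le_coe]
  push_cast
  rw [Real.coe_toNNReal _ hC0]
  have hlb : (l - b).toNat < n := by omega
  have h1 := norm_le_pi_norm (fun i : Fin n => c (b + (i : ℕ))) ⟨(l - b).toNat, hlb⟩
  have h2 : b + ((l - b).toNat : ℤ) = l := by omega
  simp only [h2] at h1
  refine h1.trans (key.trans ?_)
  rw [mul_assoc]
  refine mul_le_mul_of_nonneg_left ?_ hC0
  have h3 := Finset.sum_sigma Finset.univ (fun j => Finset.range (d j + 1))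
    (fun z : (_ : Fin N) × ℕ => ‖sampleSum m u c z.2 (x z.1)‖)
  rw [← h3]
  refine (Finset.sum_le_card_nsmul _ _ _ hmax).trans ?_
  rw [hcard, nsmul_eq_mul]

theorem exists_lpENorm_coeff_le_sampleNorm (P : IsPieces m w φ u) (hm : 1 ≤ m) {X : Set ℝ}
    {μ : ℝ → ℕ} (hX : IsSeparatedSet X) (hμ : ∀ x ∈ X, μ x ≤ m - 1)
    (hblocks : ∃ (M : ℤ) (L : ℕ) (ε : ℝ), 0 < L ∧ 0 < ε ∧
      ∀ k : ℤ, ∃ (N : ℕ) (x : Fin N → ℝ) (d : Fin N → ℕ),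
        StrictMono x ∧
        (∀ j, x j ∈ X ∩ Ico ((M : ℝ) + k * L) (M + k * L + L)) ∧
        (∀ j, d j ≤ μ (x j)) ∧
        (∑ j, (1 + d j) = L + m - 1) ∧
        (∀ j, x j ∈ Icc
          (((d j : ℝ) - m + ε) + (M + k * L + 1 + ∑ n ∈ Finset.Iio j, (1 + (d n : ℝ))))
          (-ε + (M + k * L + 1 + ∑ n ∈ Finset.Iio j, (1 + (d n : ℝ))))))
    {p : ℝ≥0∞} (hp : 1 ≤ p) : ∃ C : ℝ≥0, ∀ c : ℤ → ℂ, lpENorm p (fun l => ‖c l‖ₑ) ≤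
      C * sampleNorm X μ p (fun x => ∑' l : ℤ, c l * φ (x - l)) := by
  obtain ⟨M, L, ε, hL, hε, hblocks⟩ := hblocks
  obtain ⟨δ, hδ, hsep⟩ := hX
  obtain ⟨C, hC⟩ := P.exists_block_bound hm hε hδ hL
  -- A sample lies in the same block as the coefficient it controls, at distance less than L, so it
  -- serves at most 2L coefficients.
  refine ⟨C * ((2 * L : ℕ) : ℝ≥0), fun c => ?_⟩
  have hex : ∀ l : ℤ, ∃ z : (x : X) × Fin (μ x + 1), |(l : ℝ) - z.1| < L ∧
      ‖c l‖ₑ ≤ C * ‖sampleValue (fun x => ∑' l : ℤ, c l * φ (x - l)) z.2 z.1‖ₑ := by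
    intro l
    obtain ⟨N, x, d, hx, hxX, hdμ, hsum, hint⟩ := hblocks ((l - M) / L)
    set a : ℤ := M + (l - M) / L * L with ha
    have haR : (a : ℝ) = M + (((l - M) / L : ℤ) : ℝ) * L := by rw [ha]; push_cast; ring
    have hL' : (0 : ℤ) < L := by exact_mod_cast hL
    have h1 := Int.emod_add_mul_ediv (l - M) L
    have h2 := Int.emod_nonneg (l - M) hL'.ne'
    have h3 := Int.emod_lt_of_pos (l - M) hL'
    have hal : a ≤ l := by rw [ha, mul_comm]; omega
    have hla : l < a + L := by rw [ha, mul_comm]; omega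
    have hdm : ∀ j, d j < m := fun j => by
      have := hμ _ (hxX j).1
      have := hdμ j
      omega
    obtain ⟨j, r, hr, hle⟩ := hC c a N x d (fun j => by rw [haR]; exact (hxX j).2)
      (fun i j hij => by
        have h4 := hx hij
        have := hsep _ (hxX j).1 _ (hxX i).1 h4.ne'
        rwa [abs_of_pos (by linarith)] at this) hdm hsum (fun j => by rw [haR]; exact hint j)
      l hal hla
    refine ⟨⟨⟨x j, (hxX j).1⟩, ⟨r, Nat.lt_succ_of_le (hr.trans (hdμ j))⟩⟩, ?_, ?_⟩
    · have h5 := (hxX j).2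
      rw [← haR] at h5
      have h6 : (a : ℝ) ≤ l := by exact_mod_cast hal
      have h7 : (l : ℝ) < a + L := by exact_mod_cast hla
      rw [abs_lt]
      constructor <;> simp only <;> linarith [h5.1, h5.2]
    · simp only
      rw [(P.hasSampleValue c (hr.trans_lt (hdm j)) (x j)).2]
      exact enorm_le_of_nnnorm_le hle
  choose g hg1 hg2 using hex
  rw [sampleNorm_eq_lpENorm]
  have := lpENorm_le_of_le_comp hp (a := fun l => ‖c l‖ₑ)
    (b := fun z : (x : X) × Fin (μ x + 1) =>
      ‖sampleValue (fun x => ∑' l : ℤ, c l * φ (x - l)) z.2 z.1‖ₑ) g (C := C) (n := 2 * L)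
    (by omega) hg2 (fun z => by
      have hsub : g ⁻¹' {z} ⊆ (Finset.Ioc (⌊(z.1 : ℝ)⌋ - (L : ℤ)) (⌊(z.1 : ℝ)⌋ + L) : Set ℤ) := by
        rintro l rfl
        have := abs_lt.1 (hg1 l)
        rw [Finset.mem_coe, Finset.mem_Ioc]
        constructor
        · have h1 := Int.floor_le ((g l).1 : ℝ)
          have : ((⌊((g l).1 : ℝ)⌋ - (L : ℤ) : ℤ) : ℝ) < l := by push_cast; linarith
          exact_mod_cast this
        · have h1 := Int.lt_floor_add_one ((g l).1 : ℝ)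
          have : (l : ℝ) < ((⌊((g l).1 : ℝ)⌋ + L + 1 : ℤ) : ℝ) := by push_cast; linarith
          have := Int.cast_lt.1 this
          omega
      refine (encard_le_encard hsub).trans ?_
      rw [encard_coe_eq_coe_finsetCard, Int.card_Ioc]
      exact_mod_cast (by omega))
  refine this.trans (le_of_eq ?_)
  push_cast
  rfl

theorem exists_sampleNorm_le_lpENorm_coeff (P : IsPieces m w φ u) (hm : 1 ≤ m) {X : Set ℝ}
    {μ : ℝ → ℕ} (hX : IsSeparatedSet X) (hμ : ∀ x ∈ X, μ x ≤ m - 1)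
    {p : ℝ≥0∞} (hp : 1 ≤ p) : ∃ C : ℝ≥0, ∀ c : ℤ → ℂ,
      sampleNorm X μ p (fun x => ∑' l : ℤ, c l * φ (x - l)) ≤
        C * lpENorm p (fun l => ‖c l‖ₑ) := by
  obtain ⟨δ, hδ, hsep⟩ := hX
  obtain ⟨K, hK⟩ := P.exists_norm_pieceDeriv_le
  -- Samples dominated by c_l sit in [l, l + m). This range meets at most ⌈m / δ⌉ + 2 cells of width
  -- δ, each with at most one point of X and at most m derivatives.
  set n : ℕ := (⌈m / δ⌉.toNat + 2) * m with hn
  refine ⟨m * K * (n : ℝ≥0), fun c => ?_⟩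
  choose g hg hgmax using exists_forall_norm_le hm c
  rw [sampleNorm_eq_lpENorm]
  have hs : ∀ z : (x : X) × Fin (μ x + 1), (z.2 : ℕ) < m := fun z => by
    have := hμ _ z.1.2
    have := z.2.2
    omega
  have := lpENorm_le_of_le_comp hp
    (a := fun z : (x : X) × Fin (μ x + 1) =>
      ‖sampleValue (fun x => ∑' l : ℤ, c l * φ (x - l)) z.2 z.1‖ₑ) (b := fun l => ‖c l‖ₑ)
    (fun z => g ⌊(z.1 : ℝ)⌋) (C := ((m * K : ℝ≥0) : ℝ≥0∞)) (n := n)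
    (Nat.mul_pos (by omega) hm) (fun z => by
      rw [(P.hasSampleValue c (hs z) z.1).2]
      exact enorm_le_of_nnnorm_le <| nnnorm_sampleSum_le (hK _ (hs z)) (hgmax ⌊(z.1 : ℝ)⌋)) (fun l => by
      have hmaps : MapsTo (fun z : (x : X) × Fin (μ x + 1) => (⌊(z.1 : ℝ) / δ⌋, (z.2 : ℕ)))
          ((fun z => g ⌊(z.1 : ℝ)⌋) ⁻¹' {l})
          ((Finset.Icc ⌊(l : ℝ) / δ⌋ (⌊(l : ℝ) / δ⌋ + ⌈m / δ⌉ + 1) ×ˢ Finset.range m :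
            Finset (ℤ × ℕ)) : Set (ℤ × ℕ)) := by
        rintro z (rfl : g ⌊(z.1 : ℝ)⌋ = l)
        have h1 := Finset.mem_Ioc.1 (hg ⌊(z.1 : ℝ)⌋)
        generalize g ⌊(z.1 : ℝ)⌋ = l at h1
        have h2 : (l : ℝ) ≤ z.1 := (Int.cast_le.2 h1.2).trans (Int.floor_le _)
        have h3 : (z.1 : ℝ) < l + m := by
          have h4 : ((⌊(z.1 : ℝ)⌋ + 1 : ℤ) : ℝ) ≤ ((l + m : ℤ) : ℝ) := Int.cast_le.2 (by omega)
          push_cast at h4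
          linarith [Int.lt_floor_add_one (z.1 : ℝ)]
        rw [Finset.mem_coe, Finset.mem_product, Finset.mem_Icc, Finset.mem_range]
        refine ⟨⟨Int.floor_mono (by gcongr), ?_⟩, hs z⟩
        refine Int.lt_add_one_iff.1 (Int.floor_lt.2 ?_)
        push_cast
        have h5 : (z.1 : ℝ) / δ < (l + m) / δ := by gcongr
        rw [add_div] at h5
        linarith [Int.lt_floor_add_one ((l : ℝ) / δ), Int.le_ceil ((m : ℝ) / δ)]
      have hinj : Function.Injective
          (fun z : (x : X) × Fin (μ x + 1) => (⌊(z.1 : ℝ) / δ⌋, (z.2 : ℕ))) := by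
        rintro ⟨⟨x, hx⟩, s⟩ ⟨⟨y, hy⟩, t⟩ h
        simp only [Prod.mk.injEq] at h
        have hxy : x = y := by
          by_contra hne
          have h1 := hsep x hx y hy hne
          have h2 := Int.abs_sub_lt_one_of_floor_eq_floor h.1
          rw [← sub_div, abs_div, abs_of_pos hδ, div_lt_one hδ] at h2
          linarith
        subst hxy
        have : s = t := Fin.ext h.2
        rw [this]
      refine (encard_le_encard_of_injOn hmaps hinj.injOn).trans ?_
      rw [encard_coe_eq_coe_finsetCard, Finset.card_product, Int.card_Icc, Finset.card_range, hn]
      have h0 : 0 ≤ ⌈(m : ℝ) / δ⌉ := Int.ceil_nonneg (by positivity)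
      exact_mod_cast Nat.mul_le_mul_right m (by omega))
  refine this.trans (le_of_eq ?_)
  push_cast
  rfl

theorem exists_eLpNorm_le_lpENorm_coeff (P : IsPieces m w φ u) (hm : 1 ≤ m)
    {p : ℝ≥0∞} (hp : 1 ≤ p) : ∃ C : ℝ≥0, ∀ c : ℤ → ℂ,
      eLpNorm (fun x : ℝ => ∑' l : ℤ, c l * φ (x - l)) p volume ≤
        C * lpENorm p (fun l => ‖c l‖ₑ) := by
  obtain ⟨K, hK⟩ := P.exists_norm_pieceDeriv_le
  refine ⟨m * K * (m : ℝ≥0), fun c => ?_⟩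
  choose g hg hgmax using exists_forall_norm_le hm c
  rw [eLpNorm_eq_lpENorm hp]
  have := lpENorm_le_of_le_comp hp
    (a := fun k : ℤ => eLpNorm (fun x : ℝ => ∑' l : ℤ, c l * φ (x - l)) p
      (volume.restrict (Ioo (k : ℝ) (k + 1)))) (b := fun l => ‖c l‖ₑ)
    g (C := ((m * K : ℝ≥0) : ℝ≥0∞)) (n := m) hm (fun k => by
      have h1 : ∀ᵐ x ∂volume.restrict (Ioo (k : ℝ) (k + 1)),
          ‖∑' l : ℤ, c l * φ (x - l)‖ₑ ≤ ((m * K : ℝ≥0) : ℝ≥0∞) * ‖c (g k)‖ₑ := by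
        filter_upwards [ae_restrict_mem measurableSet_Ioo] with x hx
        have hk : ⌊x⌋ = k := Int.floor_eq_iff.2 ⟨hx.1.le, hx.2⟩
        rw [P.tsum_eq_sampleSum hm c hx, ← hk]
        exact enorm_le_of_nnnorm_le (nnnorm_sampleSum_le (hK 0 (by omega)) (hgmax ⌊x⌋))
      refine (eLpNorm_le_of_ae_enorm_bound h1).trans (le_of_eq ?_)
      simp) (fun l => by
      have hsub : g ⁻¹' {l} ⊆ (Finset.Ico l (l + m) : Set ℤ) := by
        rintro k rfl
        have := Finset.mem_Ioc.1 (hg k)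
        rw [Finset.mem_coe, Finset.mem_Ico]
        omega
      refine (encard_le_encard hsub).trans ?_
      rw [encard_coe_eq_coe_finsetCard, Int.card_Ico]
      exact_mod_cast (by omega))
  refine this.trans (le_of_eq ?_)
  push_cast
  rfl

/-- The integer translates of a PEB-spline are `p`-stable. -/
theorem exists_lpENorm_coeff_le_eLpNorm (P : IsPieces m w φ u) (hm : 1 ≤ m)
    {p : ℝ≥0∞} (hp : 1 ≤ p) : ∃ C : ℝ≥0, ∀ c : ℤ → ℂ, lpENorm p (fun l => ‖c l‖ₑ) ≤
      C * eLpNorm (fun x : ℝ => ∑' l : ℤ, c l * φ (x - l)) p volume := by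
  -- The unit interval is cut into 2m + 1 cells of length η; m alternating ones carry the nodes,
  -- leaving gaps of length η that provide both separation and margin.
  set η : ℝ := 1 / (2 * m + 1) with hη
  have hη0 : 0 < η := by positivity
  have hη1 : η * (2 * m + 1) = 1 := by rw [hη]; field_simp
  have hmR : (1 : ℝ) ≤ m := by exact_mod_cast hm
  obtain ⟨C, hC⟩ := P.exists_block_bound hm hη0 hη0 (L := 1) one_pos
  refine ⟨C * (Real.toNNReal η)⁻¹, fun c => ?_⟩
  rw [eLpNorm_eq_lpENorm hp]
  set f : ℝ → ℂ := fun x => ∑' l : ℤ, c l * φ (x - l) with hf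
  have hbound : ∀ k : ℤ, ‖c k‖ₑ ≤ ((C * (Real.toNNReal η)⁻¹ : ℝ≥0) : ℝ≥0∞) *
      eLpNorm f p (volume.restrict (Ioo (k : ℝ) (k + 1))) := by
    intro k
    have hI : ∀ j : Fin m, Icc (k + (2 * j + 1) * η) (k + (2 * j + 2) * η) ⊆
        Ioo (k : ℝ) (k + 1) := by
      intro j y hy
      have hj : (j : ℝ) + 1 ≤ m := by exact_mod_cast j.2
      have hj0 : (0 : ℝ) ≤ (j : ℕ) := Nat.cast_nonneg _
      constructor
      · nlinarith [hy.1]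
      · nlinarith [hy.2]
    -- At a minimum of |f| the value is a lower bound on the whole cell, so it is controlled by the
    -- L^p norm there.
    have hmin : ∀ j : Fin m, ∃ y ∈ Icc (k + (2 * j + 1) * η) (k + (2 * j + 2) * η),
        ∀ z ∈ Icc (k + (2 * j + 1) * η) (k + (2 * j + 2) * η), ‖f y‖ ≤ ‖f z‖ := by
      intro j
      exact isCompact_Icc.exists_isMinOn (nonempty_Icc.2 (by linarith))
        ((P.continuousOn_tsum hm c k).mono (hI j)).norm
    choose y hy hymin using hmin
    obtain ⟨j, r, hr, hle⟩ := hC c k m y (fun _ => 0)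
      (fun j => by
        have := hI j (hy j)
        exact ⟨this.1.le, by simpa using this.2⟩)
      (fun i j hij => by
        have h1 : (i : ℝ) + 1 ≤ j := by exact_mod_cast hij
        have h2 := (hy i).2
        have h3 := (hy j).1
        nlinarith)
      (fun _ => hm) (by simp)
      (fun j => by
        have hj : (j : ℝ) + 1 ≤ m := by exact_mod_cast j.2
        have hj0 : (0 : ℝ) ≤ (j : ℕ) := Nat.cast_nonneg _
        have h2 := (hy j).1
        have h3 := (hy j).2
        simp only [Nat.cast_zero, add_zero, Finset.sum_const, Fin.card_Iio, nsmul_eq_mul, mul_one]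
        constructor <;> nlinarith) k le_rfl (by simp)
    obtain rfl : r = 0 := by omega
    rw [← P.tsum_eq_sampleSum hm c (hI j (hy j))] at hle
    change ‖c k‖₊ ≤ C * ‖f (y j)‖₊ at hle
    have hlow : ‖f (y j)‖ₑ * ENNReal.ofReal η ≤
        eLpNorm f p (volume.restrict (Ioo (k : ℝ) (k + 1))) := by
      set I := Icc (k + (2 * (j : ℝ) + 1) * η) (k + (2 * (j : ℝ) + 2) * η) with hIdef
      have hvol : volume I = ENNReal.ofReal η := by
        rw [hIdef, Real.volume_Icc]; congr 1; ring
      have hne : volume.restrict I ≠ 0 := by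
        rw [Ne, Measure.restrict_eq_zero, hvol]
        simpa using hη0
      calc ‖f (y j)‖ₑ * ENNReal.ofReal η
          ≤ ‖f (y j)‖ₑ * ENNReal.ofReal η ^ (1 / p.toReal) := by
            gcongr
            conv_lhs => rw [← ENNReal.rpow_one (ENNReal.ofReal η)]
            refine ENNReal.rpow_le_rpow_of_exponent_ge ?_ ?_
            · rw [← ENNReal.ofReal_one]
              exact ENNReal.ofReal_le_ofReal (by nlinarith)
            · by_cases hpt : p = ∞
              · simp [hpt]
              · have := one_le_toReal hp hpt
                rw [div_le_one (by linarith)]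
                exact this
        _ = eLpNorm (fun _ => f (y j)) p (volume.restrict I) := by
            rw [eLpNorm_const _ (zero_lt_one.trans_le hp).ne' hne, Measure.restrict_apply_univ,
              hvol]
        _ ≤ eLpNorm f p (volume.restrict I) := by
            refine eLpNorm_mono_ae ?_
            filter_upwards [ae_restrict_mem measurableSet_Icc] with z hz using hymin j z hz
        _ ≤ _ := eLpNorm_mono_measure _ (Measure.restrict_mono_set _ (hI j))
    have hη2 : ENNReal.ofReal η ≠ 0 := by simpa using hη0
    calc ‖c k‖ₑ ≤ C * ‖f (y j)‖ₑ := enorm_le_of_nnnorm_le hle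
      _ = C * (ENNReal.ofReal η)⁻¹ * (‖f (y j)‖ₑ * ENNReal.ofReal η) := by
          rw [mul_comm ‖f (y j)‖ₑ, mul_assoc, ← mul_assoc _ (ENNReal.ofReal η),
            ENNReal.inv_mul_cancel hη2 ENNReal.ofReal_ne_top, one_mul]
      _ ≤ _ := by
          rw [ENNReal.coe_mul, ENNReal.coe_inv (by simpa using hη0)]
          exact mul_le_mul' le_rfl hlow
  have := lpENorm_le_of_le_comp hp (a := fun l => ‖c l‖ₑ)
    (b := fun k : ℤ => eLpNorm f p (volume.restrict (Ioo (k : ℝ) (k + 1)))) id (n := 1) le_rfl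
    hbound (fun k => by simp)
  simpa using this

end IsPieces

/-! ### The sampling theorem -/

theorem theorem4p2 (m : ℕ) (hm : 1 ≤ m) (φ : ℝ → ℂ) (hφ : IsPEBSpline m φ)
    (hsupp : tsupport φ = Icc (0 : ℝ) m)
    (X : Set ℝ) (μ : ℝ → ℕ) (hX : IsSeparatedSet X) (hμ : ∀ x ∈ X, μ x ≤ m - 1)
    (hblocks : ∃ (M : ℤ) (L : ℕ) (ε : ℝ), 0 < L ∧ 0 < ε ∧
      ∀ k : ℤ, ∃ (N : ℕ) (x : Fin N → ℝ) (d : Fin N → ℕ),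
        StrictMono x ∧
        (∀ j, x j ∈ X ∩ Ico ((M : ℝ) + k * L) (M + k * L + L)) ∧
        (∀ j, d j ≤ μ (x j)) ∧
        (∑ j, (1 + d j) = L + m - 1) ∧
        (∀ j, x j ∈ Icc
          (((d j : ℝ) - m + ε) + (M + k * L + 1 + ∑ n ∈ Finset.Iio j, (1 + (d n : ℝ))))
          (-ε + (M + k * L + 1 + ∑ n ∈ Finset.Iio j, (1 + (d n : ℝ)))))) :
    ∀ p : ℝ≥0∞, 1 ≤ p → IsSamplingSet X μ φ p := by
  intro p hp
  obtain ⟨w, u, P⟩ := hφ.exists_isPieces hm hsupp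
  obtain ⟨C₁, h₁⟩ := P.exists_lpENorm_coeff_le_sampleNorm hm hX hμ hblocks hp
  obtain ⟨C₂, h₂⟩ := P.exists_sampleNorm_le_lpENorm_coeff hm hX hμ hp
  obtain ⟨C₃, h₃⟩ := P.exists_eLpNorm_le_lpENorm_coeff hm hp
  obtain ⟨C₄, h₄⟩ := P.exists_lpENorm_coeff_le_eLpNorm hm hp
  refine ⟨?_, (C₃ * C₁ + 1)⁻¹, C₂ * C₄ + 1, by positivity, by positivity, ?_⟩
  · rintro f ⟨c, hc, rfl⟩
    refine ⟨⟨P.aestronglyMeasurable_tsum hm c, (h₃ c).trans_lt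
      (ENNReal.mul_lt_top ENNReal.coe_lt_top (lpENorm_lt_top_of_memℓp hp hc))⟩,
      fun x hx s hs => (P.hasSampleValue c ?_ x).1⟩
    have := hμ x hx
    omega
  · rintro f ⟨c, hc, rfl⟩
    constructor
    · rw [ENNReal.coe_inv (by positivity), mul_comm, ← div_eq_mul_inv]
      exact ENNReal.div_le_of_le_mul' (le_coe_mul_of_le_mul (h₃ c) (h₁ c))
    · exact le_coe_mul_of_le_mul (h₂ c) (h₄ c)
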